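/- Let $H$ be a separable real or complex Hilbert space and $A$ a self-adjoint operator in $H$ with domain $D(A)$ that has a complete orthonormal system of eigenvectors $(v_k)_{k\ge1}$, $Av_k=\lambda_kv_k$, with $0<\lambda_1\le\lambda_2\le\cdots\to+\infty$. Write $\psi_k=(\psi,v_k)$ for $\psi\in H$, and $\|\psi\|_1=\|A\psi\|$ for $\psi\in D(A)$. Let $\rho\in(0,1)$, $\gamma>0$, $T>0$, and let $$D_t^\rho h(t)=\frac1{\Gamma(1-\rho)}\int_0^t\frac{h'(\xi)}{(t-\xi)^\rho}\,d\xi$$ be the Caputo derivative (which exists at $t$ when this integral converges as a Bochner integral). For $\lambda>0$ and $t\ge0$ put $$A_\rho(\lambda,t)=\frac{\gamma}{\pi}\int_0^\infty e^{-rt}\,\frac{\lambda^2r^{\rho-1}\sin\rho\pi}{(-r+\lambda\gamma r^\rho\cos\rho\pi+\lambda)^2+(\lambda\gamma r^\rho\sin\rho\pi)^2}\,dr .$$ Given $\psi\in H$, a solution of the non-local problem $$D_tW(t)+A(1+\gamma D_t^\rho)W(t)=0\quad(0<t\le T),\qquad W(T)=W(0)+\psi,$$ is a function $W\in C([0,T];H)$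 such that $D_tW$, $AW$ and $AD_t^\rho W$ exist on $(0,T]$ and belong to $C((0,T];H)$ (with $D_tW(T)$ the left derivative), and which satisfies both equations. **Theorem.** For every $\psi\in D(A)$ the non-local problem has a unique solution $W$ on $[0,T]$, and $$W(t)=\sum_{k=1}^\infty\frac{A_\rho(\lambda_k,t)}{A_\rho(\lambda_k,T)-1}\,\psi_kv_k,\qquad 0\le t\le T,$$ with convergence in $H$. Moreover there is a constant $C_T>0$, depending only on $\rho,\gamma,\lambda_1$ and $T$, such that $$\|D_tW(t)\|^2+\|AW(t)\|^2+\|AD_t^\rho W(t)\|^2\le C_T\|\psi\|_1^2,\qquad 0<t\le T .$$ -/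

import Mathlib

noncomputable section

namespace RayleighStokes

/-- The scalar function `A_ρ(l, t)` (for the parameter `γ > 0`):
`A_ρ(l, t) = (γ/π) ∫_0^∞ e^{-rt} l² r^{ρ-1} sin(ρπ) /
  ((-r + l γ r^ρ cos(ρπ) + l)² + (l γ r^ρ sin(ρπ))²) dr`. -/
def relaxation (ρ γ l t : ℝ) : ℝ :=
  γ / Real.pi * ∫ r in Set.Ioi (0 : ℝ),
    Real.exp (-(r * t)) *
      (l ^ 2 * r ^ (ρ - 1) * Real.sin (ρ * Real.pi) /
        ((-r + l * γ * r ^ ρ * Real.cos (ρ * Real.pi) + l) ^ 2 +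
          (l * γ * r ^ ρ * Real.sin (ρ * Real.pi)) ^ 2))

/-- The integrand `h'(ξ) / (t - ξ)^ρ` of the Caputo derivative at time `t`. -/
def caputoIntegrand {H : Type*} [NormedAddCommGroup H] [NormedSpace ℝ H]
    (ρ : ℝ) (h : ℝ → H) (t ξ : ℝ) : H :=
  ((t - ξ) ^ ρ)⁻¹ • deriv h ξ

/-- The Caputo derivative of order `ρ` exists at `t`: its defining integral converges (in the
sense of Bochner). -/
def CaputoExists {H : Type*} [NormedAddCommGroup H] [NormedSpace ℝ H]
    (ρ : ℝ) (h : ℝ → H) (t : ℝ) : Prop :=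
  IntervalIntegrable (caputoIntegrand ρ h t) MeasureTheory.volume 0 t

/-- The Caputo derivative `D_t^ρ h(t) = (1/Γ(1-ρ)) ∫_0^t h'(ξ) (t-ξ)^{-ρ} dξ`. Only the values of
`h` on the open interval `(0, t)` matter. -/
def caputo {H : Type*} [NormedAddCommGroup H] [NormedSpace ℝ H]
    (ρ : ℝ) (h : ℝ → H) (t : ℝ) : H :=
  (Real.Gamma (1 - ρ))⁻¹ • ∫ ξ in (0 : ℝ)..t, caputoIntegrand ρ h t ξ

section Operator

variable {𝕜 : Type*} [RCLike 𝕜] {H : Type*} [NormedAddCommGroup H] [InnerProductSpace 𝕜 H]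

open Classical in
/-- The value `A x` of an unbounded operator for `x ∈ D(A)`; outside the domain the value is `0`,
and every use below comes with a proof or a requirement that `x ∈ D(A)`. -/
def opVal (A : H →ₗ.[𝕜] H) (x : H) : H :=
  if hx : x ∈ A.domain then A ⟨x, hx⟩ else 0

/-- `A` is self-adjoint and has the complete orthonormal system `v` of eigenvectors, with
positive eigenvalues `lam 0 ≤ lam 1 ≤ ⋯ → ∞`. In particular `A` is positive and unbounded. -/
structure IsDiagonalized [CompleteSpace H] (A : H →ₗ.[𝕜] H) (v : HilbertBasis ℕ 𝕜 H)
    (lam : ℕ → ℝ) : Prop where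
  selfAdjoint : IsSelfAdjoint A
  mem_domain : ∀ k, v k ∈ A.domain
  eigen : ∀ k, opVal A (v k) = (lam k : 𝕜) • v k
  pos : ∀ k, 0 < lam k
  mono : Monotone lam
  tendsto : Filter.Tendsto lam Filter.atTop Filter.atTop

/-- `W` is a solution on `[0, T]` of the homogeneous non-local problem
`D_t W(t) + A (1 + γ D_t^ρ) W(t) = 0` for `0 < t ≤ T`, `W(T) = W(0) + ψ`:
`W ∈ C([0,T]; H)`, the functions `D_t W`, `A W`, `A D_t^ρ W` exist and belong to `C((0,T]; H)`,
and the two equations hold. The derivative at the end point `T` is the left derivative. -/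
structure IsNonlocalSolution [NormedSpace ℝ H] (A : H →ₗ.[𝕜] H) (ρ γ T : ℝ) (ψ : H)
    (W : ℝ → H) : Prop where
  continuousOn : ContinuousOn W (Set.Icc 0 T)
  differentiable : ∀ t ∈ Set.Ioc 0 T, DifferentiableWithinAt ℝ W (Set.Icc 0 T) t
  continuousOn_deriv : ContinuousOn (derivWithin W (Set.Icc 0 T)) (Set.Ioc 0 T)
  mem_domain : ∀ t ∈ Set.Ioc 0 T, W t ∈ A.domain
  continuousOn_op : ContinuousOn (fun t => opVal A (W t)) (Set.Ioc 0 T)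
  caputoExists : ∀ t ∈ Set.Ioc 0 T, CaputoExists ρ W t
  caputo_mem_domain : ∀ t ∈ Set.Ioc 0 T, caputo ρ W t ∈ A.domain
  continuousOn_op_caputo : ContinuousOn (fun t => opVal A (caputo ρ W t)) (Set.Ioc 0 T)
  equation : ∀ t ∈ Set.Ioc 0 T,
    derivWithin W (Set.Icc 0 T) t + opVal A (W t + γ • caputo ρ W t) = 0
  nonlocal : W T = W 0 + ψ

end Operator

end RayleighStokes

end

/-! In the eigenbasis the problem decouples into the scalar equations y' + l(y + γ D^ρ y) = 0 with
y(T) = y(0) + ψ_k and l = λ_k. The function A_ρ(l, ·) solves this equation with initial value 1, so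
y is a multiple of it, and everything rests on estimates of A_ρ(l, ·) that are uniform in l ≥ λ₁.

Write A_ρ(l, t) = 1 - l ∫_0^t p. The kernel p is the Laplace transform of a positive density q of
total mass 1, so it decreases on [0, ∞) and lies between 0 and 1. The density is the jump of 1 / (s
+ lγs^ρ + l) across the negative axis. Cauchy's theorem, in the coordinate s = e^z where the slit
plane becomes the strip |Im z| ≤ π, shows that the Stieltjes transform of q is this very function
(`stieltjes_spectralDensity`). Hence p has Laplace transform 1 / (s + lγs^ρ + l), and injectivity of
the Laplace transform turns this into the Volterra equation p + l ∫p + lγ I^{1-ρ}p = 1, where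
I^{1-ρ} is the fractional integral (`relaxKernel_volterra`).

All three terms of that equation are nonnegative, so each is at most 1: this bounds A_ρ, its
derivative divided by l, and γ times its Caputo derivative. The denominator 1 - A_ρ(l, T) = l ∫_0^T
p is bounded below because p(T) and I^{1-ρ}p(T) are both at most a constant times ∫_0^T p, by
monotonicity and by Chebyshev's inequality (`relaxationGap_le`). Thus D_tW, AW and AD_t^ρW are
uniformly bounded diagonal operators applied to Aψ, which gives existence, continuity and the
estimate.

Uniqueness is a maximum principle (`nonpos_of_nonlocal`). The difference of two solutions, tested
against an eigenvector, satisfies w(T) = w(0), so its maximum is attained at some t₀ > 0. There both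
w' and the Caputo derivative are nonnegative, and the equation forces w(t₀) ≤ 0. -/

open Filter Topology MeasureTheory Set

noncomputable section

namespace RayleighStokes

/-! ### Contour integration on a strip and the zeros and limits of the symbol -/

section

/-- The integral of a function holomorphic on the strip `|Im z| ≤ π` along a vertical segment
tends to `2π` times its limit. -/
theorem tendsto_integral_vertical {g : ℂ → ℂ}
    (hg : ∀ z : ℂ, |z.im| ≤ Real.pi → DifferentiableAt ℂ g z)
    {F : Filter ℝ} [F.IsCountablyGenerated] {a : ℂ}
    (ha : Tendsto g (comap Complex.re F ⊓ 𝓟 {z | |z.im| ≤ Real.pi}) (𝓝 a)) :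
    Tendsto (fun R : ℝ => ∫ y in (-Real.pi)..Real.pi, g (R + y * Complex.I)) F
      (𝓝 (2 * Real.pi * a)) := by
  have hpi := Real.pi_pos
  have key : Tendsto (fun R : ℝ => ∫ y in (-Real.pi)..Real.pi, g (R + y * Complex.I)) F
      (𝓝 (∫ y in (-Real.pi)..Real.pi, a)) := by
    have hstrip : ∀ (R : ℝ) {y : ℝ}, y ∈ uIoc (-Real.pi) Real.pi →
        |((R : ℂ) + y * Complex.I).im| ≤ Real.pi := fun R y hy => by
      rw [uIoc_of_le (by linarith)] at hy
      simpa [abs_le] using ⟨hy.1.le, hy.2⟩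
    have hbd : ∀ᶠ R : ℝ in F, ∀ y ∈ uIoc (-Real.pi) Real.pi,
        ‖g (R + y * Complex.I)‖ ≤ ‖a‖ + 1 := by
      have h1 := ha.norm.eventually (eventually_le_nhds (show ‖a‖ < ‖a‖ + 1 by linarith))
      rw [eventually_inf_principal, eventually_comap] at h1
      filter_upwards [h1] with R hR y hy
      exact hR _ (by simp) (hstrip R hy)
    refine intervalIntegral.tendsto_integral_filter_of_dominated_convergence
      (fun _ => ‖a‖ + 1) (Eventually.of_forall fun R => ?_) ?_ intervalIntegrable_const ?_
    · refine ContinuousOn.aestronglyMeasurable (fun y hy => ?_) measurableSet_uIoc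
      have h2 : ContinuousAt g (R + y * Complex.I) := (hg _ (hstrip R hy)).continuousAt
      have h3 : ContinuousAt (fun y : ℝ => (R : ℂ) + y * Complex.I) y := by fun_prop
      exact (ContinuousAt.comp (f := fun y : ℝ => (R : ℂ) + y * Complex.I) h2 h3).continuousWithinAt
    · filter_upwards [hbd] with R hR
      exact ae_of_all _ fun y hy => hR y hy
    · refine ae_of_all _ fun y hy => ha.comp ?_
      refine tendsto_inf.2 ⟨tendsto_comap_iff.2 (tendsto_id.congr fun R => ?_),
        tendsto_principal.2 (Eventually.of_forall fun R => hstrip R hy)⟩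
      simp
  rw [intervalIntegral.integral_const] at key
  convert key using 2
  rw [Complex.real_smul]
  push_cast
  ring

/-- **Cauchy's theorem on a strip**: for a function holomorphic on `|Im z| ≤ π` with limits at both
ends, the difference of the integrals along the two boundary lines. -/
theorem tendsto_integral_strip {g : ℂ → ℂ}
    (hg : ∀ z : ℂ, |z.im| ≤ Real.pi → DifferentiableAt ℂ g z)
    {a b : ℂ} (ha : Tendsto g (comap Complex.re atTop ⊓ 𝓟 {z | |z.im| ≤ Real.pi}) (𝓝 a))
    (hb : Tendsto g (comap Complex.re atBot ⊓ 𝓟 {z | |z.im| ≤ Real.pi}) (𝓝 b)) :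
    Tendsto (fun R : ℝ => ∫ x in (-R)..R,
      (g (x - Real.pi * Complex.I) - g (x + Real.pi * Complex.I))) atTop
      (𝓝 (2 * Real.pi * Complex.I * (b - a))) := by
  have hpi := Real.pi_pos
  have h1 := tendsto_integral_vertical hg ha
  have h2 := (tendsto_integral_vertical hg hb).comp tendsto_neg_atTop_atBot
  have h3 := ((h2.sub h1).const_mul Complex.I)
  have h4 : 2 * Real.pi * Complex.I * (b - a)
      = Complex.I * (2 * Real.pi * b - 2 * Real.pi * a) := by ring
  rw [h4]
  refine h3.congr fun R => ?_
  have hline : ∀ c : ℝ, |c| ≤ Real.pi →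
      Continuous (fun x : ℝ => g (x + c * Complex.I)) := fun c hc => by
    rw [continuous_iff_continuousAt]
    intro x
    have h2 : ContinuousAt g (x + c * Complex.I) := (hg _ (by simpa using hc)).continuousAt
    exact ContinuousAt.comp (f := fun x : ℝ => (x : ℂ) + c * Complex.I) h2 (by fun_prop)
  have hrect := Complex.integral_boundary_rect_eq_zero_of_differentiableOn g
    (⟨-R, -Real.pi⟩ : ℂ) (⟨R, Real.pi⟩ : ℂ) (fun z hz => by
      refine (hg z ?_).differentiableWithinAt
      have := hz.2
      simp only [mem_preimage, uIcc_of_le (show -Real.pi ≤ Real.pi by linarith), mem_Icc] at this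
      exact abs_le.2 this)
  have c1 := hline (-Real.pi) (by rw [abs_neg, abs_of_pos hpi])
  have c2 := hline Real.pi (by rw [abs_of_pos hpi])
  simp only [smul_eq_mul, Complex.ofReal_neg, neg_mul, ← sub_eq_add_neg] at hrect c1
  rw [intervalIntegral.integral_sub (c1.intervalIntegrable _ _) (c2.intervalIntegrable _ _)]
  simp only [Function.comp_apply, Complex.ofReal_neg]
  linear_combination -hrect

/-- The symbol `s + lγ s^ρ + l` in the logarithmic coordinate `s = e^z`. -/
def symbol (ρ γ l : ℝ) (z : ℂ) : ℂ :=
  Complex.exp z + l * γ * Complex.exp (ρ * z) + l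

/-- The density `q` with `∫ q(r) / (s + r) dr = 1 / (s + lγ s^ρ + l)`. -/
def spectralDensity (ρ γ l r : ℝ) : ℝ :=
  Real.pi⁻¹ * (l * γ * r ^ ρ * Real.sin (ρ * Real.pi) /
    ((-r + l * γ * r ^ ρ * Real.cos (ρ * Real.pi) + l) ^ 2 +
      (l * γ * r ^ ρ * Real.sin (ρ * Real.pi)) ^ 2))

theorem differentiable_symbol (ρ γ l : ℝ) : Differentiable ℂ (symbol ρ γ l) := by
  unfold symbol
  fun_prop

theorem symbol_im (ρ γ l : ℝ) (z : ℂ) : (symbol ρ γ l z).im =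
    Real.exp z.re * Real.sin z.im + l * γ * (Real.exp (ρ * z.re) * Real.sin (ρ * z.im)) := by
  simp [symbol, Complex.exp_im, Complex.exp_re]

theorem symbol_re (ρ γ l : ℝ) (z : ℂ) : (symbol ρ γ l z).re =
    Real.exp z.re * Real.cos z.im + l * γ * (Real.exp (ρ * z.re) * Real.cos (ρ * z.im)) + l := by
  simp [symbol, Complex.exp_im, Complex.exp_re]

variable {ρ γ l : ℝ}

/-- Since ρ|Im z| < π, for Im z ≠ 0 the number sin(ρ Im z) has strictly, and sin(Im z) weakly, the
sign of Im z; the imaginary part of the symbol cannot vanish. On the real axis the symbol is a sum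
of positive terms. -/
theorem symbol_ne_zero (hρ0 : 0 < ρ) (hρ1 : ρ < 1) (hγ : 0 < γ) (hl : 0 < l) {z : ℂ}
    (hz : |z.im| ≤ Real.pi) : symbol ρ γ l z ≠ 0 := by
  intro h0
  have him : (symbol ρ γ l z).im = 0 := by rw [h0]; rfl
  rw [symbol_im] at him
  have hlγ : 0 < l * γ := mul_pos hl hγ
  have e1 := Real.exp_pos z.re
  have e2 := Real.exp_pos (ρ * z.re)
  rw [abs_le] at hz
  rcases lt_trichotomy z.im 0 with h | h | h
  · have s1 : Real.sin z.im ≤ 0 := Real.sin_nonpos_of_nonpos_of_neg_pi_le h.le hz.1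
    have s2 : Real.sin (ρ * z.im) < 0 :=
      Real.sin_neg_of_neg_of_neg_pi_lt (by nlinarith) (by nlinarith)
    have := mul_neg_of_pos_of_neg hlγ (mul_neg_of_pos_of_neg e2 s2)
    nlinarith
  · have hre : (symbol ρ γ l z).re = 0 := by rw [h0]; rfl
    simp [symbol, Complex.exp_re, Complex.exp_im, h] at hre
    have := mul_pos hlγ e2
    linarith
  · have s1 : 0 ≤ Real.sin z.im := Real.sin_nonneg_of_nonneg_of_le_pi h.le hz.2
    have s2 : 0 < Real.sin (ρ * z.im) :=
      Real.sin_pos_of_pos_of_lt_pi (by positivity) (by nlinarith)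
    have := mul_pos hlγ (mul_pos e2 s2)
    nlinarith

theorem sin_mul_pi_pos (hρ0 : 0 < ρ) (hρ1 : ρ < 1) : 0 < Real.sin (ρ * Real.pi) :=
  Real.sin_pos_of_pos_of_lt_pi (by positivity) (by nlinarith [Real.pi_pos])

theorem density_denom_pos (hρ0 : 0 < ρ) (hρ1 : ρ < 1) (hγ : 0 < γ) (hl : 0 < l) {r : ℝ}
    (hr : 0 < r) : 0 < (-r + l * γ * r ^ ρ * Real.cos (ρ * Real.pi) + l) ^ 2 +
      (l * γ * r ^ ρ * Real.sin (ρ * Real.pi)) ^ 2 := by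
  have := sin_mul_pi_pos hρ0 hρ1
  positivity

theorem spectralDensity_pos (hρ0 : 0 < ρ) (hρ1 : ρ < 1) (hγ : 0 < γ) (hl : 0 < l) {r : ℝ}
    (hr : 0 < r) : 0 < spectralDensity ρ γ l r := by
  have := sin_mul_pi_pos hρ0 hρ1
  have := density_denom_pos hρ0 hρ1 hγ hl hr
  have := Real.pi_pos
  unfold spectralDensity
  positivity

theorem continuousOn_spectralDensity (hρ0 : 0 < ρ) (hρ1 : ρ < 1) (hγ : 0 < γ) (hl : 0 < l) :
    ContinuousOn (spectralDensity ρ γ l) (Ioi 0) := by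
  have hp : ContinuousOn (fun r : ℝ => r ^ ρ) (Ioi 0) :=
    fun r hr => (Real.continuousAt_rpow_const r ρ (Or.inl (ne_of_gt hr))).continuousWithinAt
  unfold spectralDensity
  refine continuousOn_const.mul (ContinuousOn.div (by fun_prop) (by fun_prop) fun r hr => ?_)
  exact (density_denom_pos hρ0 hρ1 hγ hl hr).ne'

/-- On the lines Im z = ∓π the symbol takes conjugate values u ∓ iw, so the inverses differ by 2iw /
(u² + w²). This is where the formula for `spectralDensity` comes from. -/
theorem inv_symbol_jump (hρ0 : 0 < ρ) (hρ1 : ρ < 1) (hγ : 0 < γ) (hl : 0 < l) (x : ℝ) :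
    (symbol ρ γ l (x - Real.pi * Complex.I))⁻¹ - (symbol ρ γ l (x + Real.pi * Complex.I))⁻¹ =
      2 * Real.pi * Complex.I * (spectralDensity ρ γ l (Real.exp x) : ℝ) := by
  have hpi := Real.pi_pos
  obtain ⟨u, hu⟩ : ∃ u : ℝ,
      u = -Real.exp x + l * γ * (Real.exp x) ^ ρ * Real.cos (ρ * Real.pi) + l := ⟨_, rfl⟩
  obtain ⟨w, hw⟩ : ∃ w : ℝ, w = l * γ * (Real.exp x) ^ ρ * Real.sin (ρ * Real.pi) := ⟨_, rfl⟩
  have hexp : (Real.exp x) ^ ρ = Real.exp (ρ * x) := by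
    rw [← Real.exp_mul, mul_comm]
  have h1 : symbol ρ γ l (x - Real.pi * Complex.I) = u - w * Complex.I := by
    apply Complex.ext
    · rw [symbol_re]; simp; rw [hu, hexp]; ring
    · rw [symbol_im]; simp; rw [hw, hexp]; ring
  have h2 : symbol ρ γ l (x + Real.pi * Complex.I) = u + w * Complex.I := by
    apply Complex.ext
    · rw [symbol_re]; simp; rw [hu, hexp]; ring
    · rw [symbol_im]; simp; rw [hw, hexp]; ring
  have n1 : symbol ρ γ l (x - Real.pi * Complex.I) ≠ 0 :=
    symbol_ne_zero hρ0 hρ1 hγ hl (by simp [abs_of_pos hpi])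
  have n2 : symbol ρ γ l (x + Real.pi * Complex.I) ≠ 0 :=
    symbol_ne_zero hρ0 hρ1 hγ hl (by simp [abs_of_pos hpi])
  have hD : (0 : ℝ) < u ^ 2 + w ^ 2 := by
    rw [hu, hw]; exact density_denom_pos hρ0 hρ1 hγ hl (Real.exp_pos x)
  have hD' : ((u : ℂ) ^ 2 + (w : ℂ) ^ 2) ≠ 0 := by exact_mod_cast hD.ne'
  have hpi' : (Real.pi : ℂ) ≠ 0 := by exact_mod_cast hpi.ne'
  have hq : (spectralDensity ρ γ l (Real.exp x) : ℝ) = Real.pi⁻¹ * (w / (u ^ 2 + w ^ 2)) := by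
    rw [hu, hw]; rfl
  rw [h1] at n1 ⊢
  rw [h2] at n2 ⊢
  rw [hq]
  have hprod : ((u : ℂ) - w * Complex.I) * (u + w * Complex.I) = (u : ℂ) ^ 2 + (w : ℂ) ^ 2 := by
    linear_combination (-(w : ℂ) ^ 2) * Complex.I_sq
  rw [inv_sub_inv n1 n2, hprod]
  push_cast
  field_simp
  ring

theorem tendsto_exp_mul_right {c : ℝ} (hc : c < 0) :
    Tendsto (fun z : ℂ => Complex.exp (c * z)) (comap Complex.re atTop) (𝓝 0) := by
  rw [tendsto_zero_iff_norm_tendsto_zero]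
  simp only [Complex.norm_exp, Complex.re_ofReal_mul]
  exact Real.tendsto_exp_atBot.comp ((tendsto_comap).const_mul_atTop_of_neg hc)

theorem tendsto_exp_mul_left {c : ℝ} (hc : 0 < c) :
    Tendsto (fun z : ℂ => Complex.exp (c * z)) (comap Complex.re atBot) (𝓝 0) := by
  rw [tendsto_zero_iff_norm_tendsto_zero]
  simp only [Complex.norm_exp, Complex.re_ofReal_mul]
  exact Real.tendsto_exp_atBot.comp ((tendsto_comap).const_mul_atBot hc)

theorem tendsto_exp_left : Tendsto Complex.exp (comap Complex.re atBot) (𝓝 0) := by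
  simpa using tendsto_exp_mul_left one_pos

theorem tendsto_exp_neg_right :
    Tendsto (fun z => Complex.exp (-z)) (comap Complex.re atTop) (𝓝 0) := by
  simpa using tendsto_exp_mul_right (c := -1) (by norm_num)

theorem tendsto_exp_div_symbol_right (hρ1 : ρ < 1) :
    Tendsto (fun z => Complex.exp z * (symbol ρ γ l z)⁻¹) (comap Complex.re atTop) (𝓝 1) := by
  have h1 : Tendsto (fun z : ℂ => 1 + l * γ * Complex.exp ((ρ - 1 : ℝ) * z)
      + l * Complex.exp (-z)) (comap Complex.re atTop) (𝓝 (1 + l * γ * 0 + l * 0)) :=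
    ((tendsto_const_nhds.add ((tendsto_exp_mul_right (by linarith)).const_mul _)).add
      (tendsto_exp_neg_right.const_mul _))
  have h2 := h1.inv₀ (by simp)
  simp only [mul_zero, add_zero, inv_one] at h2
  refine h2.congr fun z => ?_
  have h3 : symbol ρ γ l z = Complex.exp z * (1 + l * γ * Complex.exp ((ρ - 1 : ℝ) * z)
      + l * Complex.exp (-z)) := by
    have e1 : Complex.exp (ρ * z) = Complex.exp z * Complex.exp ((ρ - 1 : ℝ) * z) := by
      rw [← Complex.exp_add]; congr 1; push_cast; ring
    have e2 : Complex.exp z * Complex.exp (-z) = 1 := by rw [← Complex.exp_add]; simp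
    rw [symbol, e1]
    linear_combination (-(l : ℂ)) * e2
  rw [h3, mul_inv, mul_inv_cancel_left₀ (Complex.exp_ne_zero z)]

theorem tendsto_inv_symbol_right (hρ1 : ρ < 1) :
    Tendsto (fun z => (symbol ρ γ l z)⁻¹) (comap Complex.re atTop) (𝓝 0) := by
  have h := tendsto_exp_neg_right.mul (tendsto_exp_div_symbol_right (γ := γ) (l := l) hρ1)
  rw [zero_mul] at h
  refine h.congr fun z => ?_
  rw [← mul_assoc, ← Complex.exp_add]
  simp

theorem tendsto_inv_symbol_left (hρ0 : 0 < ρ) (hl : 0 < l) :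
    Tendsto (fun z => (symbol ρ γ l z)⁻¹) (comap Complex.re atBot) (𝓝 (l : ℂ)⁻¹) := by
  have h1 : Tendsto (symbol ρ γ l) (comap Complex.re atBot) (𝓝 (0 + l * γ * 0 + l)) :=
    (tendsto_exp_left.add ((tendsto_exp_mul_left hρ0).const_mul _)).add tendsto_const_nhds
  simp only [mul_zero, zero_add] at h1
  exact h1.inv₀ (by exact_mod_cast hl.ne')

end

/-! ### Moments and Stieltjes transform of the spectral density -/

section

/-- For a nonnegative function, convergence of the symmetric integrals already forces integrability.
The contour computations therefore give integrability along with the value, and no decay estimate on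
the density is needed. -/
theorem integrable_of_tendsto_of_nonneg {h : ℝ → ℝ} (hc : Continuous h) (h0 : ∀ x, 0 ≤ h x) {c : ℂ}
    (ht : Tendsto (fun R : ℝ => ∫ x in (-R)..R, (2 * Real.pi * Complex.I * (h x : ℝ) : ℂ)) atTop
      (𝓝 (2 * Real.pi * Complex.I * c))) : Integrable h := by
  have hpi : (2 * Real.pi * Complex.I : ℂ) ≠ 0 := by
    simp [Real.pi_ne_zero]
  have h1 := ht.const_mul (2 * Real.pi * Complex.I : ℂ)⁻¹
  simp only [intervalIntegral.integral_const_mul, inv_mul_cancel_left₀ hpi,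
    intervalIntegral.integral_ofReal] at h1
  have h2 := (Complex.continuous_re.tendsto _).comp h1
  refine integrable_of_intervalIntegral_norm_tendsto (l := (atTop : Filter ℝ)) (c.re)
    (a := fun R => -R) (b := id)
    (fun i => hc.integrableOn_Ioc) tendsto_neg_atTop_atBot tendsto_id ?_
  refine h2.congr fun R => ?_
  simp [abs_of_nonneg (h0 _)]

theorem integral_eq_of_tendsto {h : ℝ → ℂ} (hi : Integrable h) {c : ℂ}
    (ht : Tendsto (fun R : ℝ => ∫ x in (-R)..R, (2 * Real.pi * Complex.I * h x : ℂ)) atTop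
      (𝓝 (2 * Real.pi * Complex.I * c))) : ∫ x, h x = c := by
  have hpi : (2 * Real.pi * Complex.I : ℂ) ≠ 0 := by
    simp [Real.pi_ne_zero]
  have h1 := ht.const_mul (2 * Real.pi * Complex.I : ℂ)⁻¹
  simp only [intervalIntegral.integral_const_mul, inv_mul_cancel_left₀ hpi] at h1
  exact tendsto_nhds_unique
    (intervalIntegral_tendsto_integral hi tendsto_neg_atTop_atBot tendsto_id) h1

theorem exp_image_univ : Real.exp '' univ = Ioi 0 := by
  rw [image_univ, Real.range_exp]

theorem integrableOn_Ioi_iff_comp_exp {E : Type*} [NormedAddCommGroup E] [NormedSpace ℝ E]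
    (f : ℝ → E) : IntegrableOn f (Ioi 0) ↔ Integrable fun x => Real.exp x • f (Real.exp x) := by
  rw [← exp_image_univ, integrableOn_image_iff_integrableOn_abs_deriv_smul MeasurableSet.univ
    (fun x _ => (Real.hasDerivAt_exp x).hasDerivWithinAt) Real.exp_injective.injOn,
    integrableOn_univ]
  simp [Real.abs_exp]

theorem integral_Ioi_eq_comp_exp {E : Type*} [NormedAddCommGroup E] [NormedSpace ℝ E]
    (f : ℝ → E) : ∫ r in Ioi 0, f r = ∫ x, Real.exp x • f (Real.exp x) := by
  rw [← exp_image_univ, integral_image_eq_integral_abs_deriv_smul MeasurableSet.univ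
    (fun x _ => (Real.hasDerivAt_exp x).hasDerivWithinAt) Real.exp_injective.injOn,
    setIntegral_univ]
  simp [Real.abs_exp]

variable {ρ γ l : ℝ}

theorem continuous_spectralDensity_exp (hρ0 : 0 < ρ) (hρ1 : ρ < 1) (hγ : 0 < γ) (hl : 0 < l) :
    Continuous fun x => spectralDensity ρ γ l (Real.exp x) :=
  (continuousOn_spectralDensity hρ0 hρ1 hγ hl).comp_continuous Real.continuous_exp
    fun x => Real.exp_pos x

theorem tendsto_integral_density (hρ0 : 0 < ρ) (hρ1 : ρ < 1) (hγ : 0 < γ) (hl : 0 < l) :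
    Tendsto (fun R : ℝ => ∫ x in (-R)..R,
      (2 * Real.pi * Complex.I * (spectralDensity ρ γ l (Real.exp x) : ℝ) : ℂ)) atTop
      (𝓝 (2 * Real.pi * Complex.I * (l : ℂ)⁻¹)) := by
  have h := tendsto_integral_strip (g := fun z => (symbol ρ γ l z)⁻¹)
    (fun z hz => ((differentiable_symbol ρ γ l) z).inv (symbol_ne_zero hρ0 hρ1 hγ hl hz))
    ((tendsto_inv_symbol_right hρ1).mono_left inf_le_left)
    ((tendsto_inv_symbol_left hρ0 hl).mono_left inf_le_left)
  simpa only [inv_symbol_jump hρ0 hρ1 hγ hl, sub_zero] using h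

theorem exp_pm_pi (x : ℝ) : Complex.exp (x - Real.pi * Complex.I) = -(Real.exp x : ℝ) ∧
    Complex.exp (x + Real.pi * Complex.I) = -(Real.exp x : ℝ) := by
  constructor
  · rw [Complex.exp_sub, Complex.exp_pi_mul_I]; simp [div_neg]
  · rw [Complex.exp_add, Complex.exp_pi_mul_I]; simp

theorem tendsto_integral_exp_mul_density (hρ0 : 0 < ρ) (hρ1 : ρ < 1) (hγ : 0 < γ) (hl : 0 < l) :
    Tendsto (fun R : ℝ => ∫ x in (-R)..R,
      (2 * Real.pi * Complex.I * (Real.exp x * spectralDensity ρ γ l (Real.exp x) : ℝ) : ℂ)) atTop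
      (𝓝 (2 * Real.pi * Complex.I * 1)) := by
  have h0 := tendsto_exp_left.mul (tendsto_inv_symbol_left (γ := γ) hρ0 hl)
  rw [zero_mul] at h0
  have h := tendsto_integral_strip (g := fun z => Complex.exp z * (symbol ρ γ l z)⁻¹)
    (fun z hz => Complex.differentiableAt_exp.mul
      (((differentiable_symbol ρ γ l) z).inv (symbol_ne_zero hρ0 hρ1 hγ hl hz)))
    ((tendsto_exp_div_symbol_right hρ1).mono_left inf_le_left) (h0.mono_left inf_le_left)
  -- On both boundary lines e^z = -e^x, which flips the sign of the jump.
  have h2 := h.neg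
  rw [show -(2 * Real.pi * Complex.I * (0 - 1) : ℂ) = 2 * Real.pi * Complex.I * 1 by ring] at h2
  refine h2.congr fun R => ?_
  rw [← intervalIntegral.integral_neg]
  refine intervalIntegral.integral_congr fun x _ => ?_
  rw [(exp_pm_pi x).1, (exp_pm_pi x).2]
  have := inv_symbol_jump hρ0 hρ1 hγ hl x
  push_cast
  linear_combination (Complex.exp x) * this

theorem integrableOn_spectralDensity_div (hρ0 : 0 < ρ) (hρ1 : ρ < 1) (hγ : 0 < γ) (hl : 0 < l) :
    IntegrableOn (fun r => spectralDensity ρ γ l r / r) (Ioi 0) := by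
  rw [integrableOn_Ioi_iff_comp_exp]
  have h := integrable_of_tendsto_of_nonneg (continuous_spectralDensity_exp hρ0 hρ1 hγ hl)
    (fun x => (spectralDensity_pos hρ0 hρ1 hγ hl (Real.exp_pos x)).le)
    (tendsto_integral_density hρ0 hρ1 hγ hl)
  refine h.congr (ae_of_all _ fun x => ?_)
  simp only [smul_eq_mul]
  field_simp

theorem integral_spectralDensity_div (hρ0 : 0 < ρ) (hρ1 : ρ < 1) (hγ : 0 < γ) (hl : 0 < l) :
    ∫ r in Ioi 0, spectralDensity ρ γ l r / r = l⁻¹ := by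
  have h1 : ∫ x, ((spectralDensity ρ γ l (Real.exp x) : ℝ) : ℂ) = (l : ℂ)⁻¹ :=
    integral_eq_of_tendsto (integrable_of_tendsto_of_nonneg
    (continuous_spectralDensity_exp hρ0 hρ1 hγ hl)
    (fun x => (spectralDensity_pos hρ0 hρ1 hγ hl (Real.exp_pos x)).le)
    (tendsto_integral_density hρ0 hρ1 hγ hl)).ofReal (tendsto_integral_density hρ0 hρ1 hγ hl)
  rw [integral_complex_ofReal] at h1
  rw [integral_Ioi_eq_comp_exp]
  have h2 : ∫ x, spectralDensity ρ γ l (Real.exp x) = l⁻¹ := by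
    rw [← Complex.ofReal_inv] at h1
    exact_mod_cast h1
  rw [← h2]
  refine integral_congr_ae (ae_of_all _ fun x => ?_)
  simp only [smul_eq_mul]
  field_simp

theorem integrable_exp_mul_density (hρ0 : 0 < ρ) (hρ1 : ρ < 1) (hγ : 0 < γ) (hl : 0 < l) :
    Integrable fun x => Real.exp x * spectralDensity ρ γ l (Real.exp x) :=
  integrable_of_tendsto_of_nonneg
    (Real.continuous_exp.mul (continuous_spectralDensity_exp hρ0 hρ1 hγ hl))
    (fun x => mul_nonneg (Real.exp_pos x).le
      (spectralDensity_pos hρ0 hρ1 hγ hl (Real.exp_pos x)).le)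
    (tendsto_integral_exp_mul_density hρ0 hρ1 hγ hl)

theorem integrableOn_spectralDensity (hρ0 : 0 < ρ) (hρ1 : ρ < 1) (hγ : 0 < γ) (hl : 0 < l) :
    IntegrableOn (spectralDensity ρ γ l) (Ioi 0) := by
  rw [integrableOn_Ioi_iff_comp_exp]
  exact integrable_exp_mul_density hρ0 hρ1 hγ hl

theorem integral_spectralDensity (hρ0 : 0 < ρ) (hρ1 : ρ < 1) (hγ : 0 < γ) (hl : 0 < l) :
    ∫ r in Ioi 0, spectralDensity ρ γ l r = 1 := by
  have h1 : ∫ x, ((Real.exp x * spectralDensity ρ γ l (Real.exp x) : ℝ) : ℂ) = 1 :=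
    integral_eq_of_tendsto (integrable_exp_mul_density hρ0 hρ1 hγ hl).ofReal
    (tendsto_integral_exp_mul_density hρ0 hρ1 hγ hl)
  rw [integral_complex_ofReal] at h1
  rw [integral_Ioi_eq_comp_exp]
  simpa using congrArg Complex.re h1

/-- Two logarithms of the same number differ by 2πin, and |Im z - Im z₀| < 3π/2 leaves only n = 0.
The closed strip covers the cut twice, so z₀ must stay away from its boundary. -/
theorem exp_injOn_strip {z z₀ : ℂ} (hz : |z.im| ≤ Real.pi) (hz₀ : |z₀.im| < Real.pi / 2)
    (h : Complex.exp z = Complex.exp z₀) : z = z₀ := by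
  obtain ⟨n, hn⟩ := Complex.exp_eq_exp_iff_exists_int.1 h
  have him : z.im = z₀.im + n * (2 * Real.pi) := by
    rw [hn]; simp
  have hpi := Real.pi_pos
  rw [abs_le] at hz
  rw [abs_lt] at hz₀
  have h1 : (n : ℝ) < 1 := by
    by_contra hc
    push Not at hc
    nlinarith [hz.2, hz₀.1]
  have h2 : (-1 : ℝ) < n := by
    by_contra hc
    push Not at hc
    nlinarith [hz.1, hz₀.2]
  have h3 : n = 0 := by
    have h1' : n < 1 := by exact_mod_cast h1
    have h2' : -1 < n := by exact_mod_cast h2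
    omega
  rw [hn, h3]; simp

/-- `z ↦ (1 / symbol z - 1 / symbol z₀) e^z / (e^z - e^{z₀})` with the singularity at `z₀`
removed. -/
def cauchyKernel (ρ γ l : ℝ) (z₀ z : ℂ) : ℂ :=
  -(dslope (symbol ρ γ l) z₀ z) * Complex.exp z /
    (symbol ρ γ l z * symbol ρ γ l z₀ * dslope Complex.exp z₀ z)

/-- Subtracting the constant 1 / symbol z₀ cancels the simple pole of e^z / (e^z - e^{z₀}), so
Cauchy's theorem without residues suffices. The divided differences in `cauchyKernel` express the
same function without a singularity. -/
theorem cauchyKernel_of_ne (hρ0 : 0 < ρ) (hρ1 : ρ < 1) (hγ : 0 < γ) (hl : 0 < l) {z₀ z : ℂ}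
    (hz : |z.im| ≤ Real.pi) (hz₀ : |z₀.im| < Real.pi / 2) (hne : z ≠ z₀) :
    cauchyKernel ρ γ l z₀ z = ((symbol ρ γ l z)⁻¹ - (symbol ρ γ l z₀)⁻¹) *
      (Complex.exp z / (Complex.exp z - Complex.exp z₀)) := by
  have n1 := symbol_ne_zero hρ0 hρ1 hγ hl hz
  have n2 := symbol_ne_zero hρ0 hρ1 hγ hl (z := z₀) (by linarith [Real.pi_pos])
  have n3 : Complex.exp z - Complex.exp z₀ ≠ 0 :=
    sub_ne_zero.2 fun h => hne (exp_injOn_strip hz hz₀ h)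
  have n4 : z - z₀ ≠ 0 := sub_ne_zero.2 hne
  rw [cauchyKernel, dslope_of_ne _ hne, dslope_of_ne _ hne, slope_def_field, slope_def_field]
  field_simp
  ring

theorem differentiableAt_cauchyKernel (hρ0 : 0 < ρ) (hρ1 : ρ < 1) (hγ : 0 < γ) (hl : 0 < l)
    {z₀ z : ℂ} (hz : |z.im| ≤ Real.pi) (hz₀ : |z₀.im| < Real.pi / 2) :
    DifferentiableAt ℂ (cauchyKernel ρ γ l z₀) z := by
  have n1 := symbol_ne_zero hρ0 hρ1 hγ hl hz
  have n2 := symbol_ne_zero hρ0 hρ1 hγ hl (z := z₀) (by linarith [Real.pi_pos])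
  have d : ∀ f : ℂ → ℂ, Differentiable ℂ f → DifferentiableAt ℂ (dslope f z₀) z := fun f hf =>
    ((Complex.differentiableOn_dslope univ_mem).2 hf.differentiableOn).differentiableAt univ_mem
  have n3 : dslope Complex.exp z₀ z ≠ 0 := by
    by_cases hne : z = z₀
    · rw [hne, dslope_same, Complex.deriv_exp]
      exact Complex.exp_ne_zero _
    · rw [dslope_of_ne _ hne, slope_def_field]
      exact div_ne_zero (sub_ne_zero.2 fun h => hne (exp_injOn_strip hz hz₀ h))
        (sub_ne_zero.2 hne)
  have d1 := d _ (differentiable_symbol ρ γ l)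
  have d2 := d _ Complex.differentiable_exp
  have d3 := differentiable_symbol ρ γ l z
  unfold cauchyKernel
  exact (d1.neg.mul Complex.differentiableAt_exp).div ((d3.mul_const _).mul d2)
    (mul_ne_zero (mul_ne_zero n1 n2) n3)

/-- The factor e^z / (e^z - e^{z₀}) agrees on the two boundary lines, so the subtracted constant
drops out of the jump. It survives only in the limit at the right end, -1 / symbol z₀, which
supplies the value of the integral. -/
theorem tendsto_integral_stieltjes (hρ0 : 0 < ρ) (hρ1 : ρ < 1) (hγ : 0 < γ) (hl : 0 < l)
    {z₀ : ℂ} (hz₀ : |z₀.im| < Real.pi / 2) :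
    Tendsto (fun R : ℝ => ∫ x in (-R)..R,
      (2 * Real.pi * Complex.I * ((Real.exp x * spectralDensity ρ γ l (Real.exp x) : ℝ) *
        (Real.exp x + Complex.exp z₀)⁻¹) : ℂ)) atTop
      (𝓝 (2 * Real.pi * Complex.I * (symbol ρ γ l z₀)⁻¹)) := by
  have hpi := Real.pi_pos
  have hR : Tendsto (fun z : ℂ => Complex.exp z / (Complex.exp z - Complex.exp z₀))
      (comap Complex.re atTop) (𝓝 1) := by
    have h1 : Tendsto (fun z : ℂ => (1 - Complex.exp z₀ * Complex.exp (-z))⁻¹)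
        (comap Complex.re atTop) (𝓝 (1 - Complex.exp z₀ * 0)⁻¹) :=
      ((tendsto_const_nhds (x := (1 : ℂ))).sub (tendsto_exp_neg_right.const_mul _)).inv₀ (by simp)
    rw [mul_zero, sub_zero, inv_one] at h1
    refine h1.congr fun z => ?_
    have e2 : Complex.exp z * Complex.exp (-z) = 1 := by rw [← Complex.exp_add]; simp
    have h3 : Complex.exp z - Complex.exp z₀ =
        Complex.exp z * (1 - Complex.exp z₀ * Complex.exp (-z)) := by
      linear_combination Complex.exp z₀ * e2
    rw [h3, div_mul_eq_div_div, div_self (Complex.exp_ne_zero z), one_div]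
  have hL : Tendsto (fun z : ℂ => Complex.exp z / (Complex.exp z - Complex.exp z₀))
      (comap Complex.re atBot) (𝓝 0) := by
    have h1 := tendsto_exp_left.div (tendsto_exp_left.sub_const (Complex.exp z₀))
      (by simp [Complex.exp_ne_zero])
    simpa [Pi.div_def] using h1
  have ha : Tendsto (cauchyKernel ρ γ l z₀) (comap Complex.re atTop ⊓ 𝓟 {z | |z.im| ≤ Real.pi})
      (𝓝 ((0 - (symbol ρ γ l z₀)⁻¹) * 1)) := by
    have h1 := (((tendsto_inv_symbol_right (γ := γ) (l := l) hρ1).sub_const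
      (symbol ρ γ l z₀)⁻¹).mul hR).mono_left
      (inf_le_left (b := 𝓟 {z : ℂ | |z.im| ≤ Real.pi}))
    refine h1.congr' ?_
    rw [EventuallyEq, eventually_inf_principal]
    filter_upwards [tendsto_comap.eventually (eventually_gt_atTop z₀.re)] with z hz hs
    exact (cauchyKernel_of_ne hρ0 hρ1 hγ hl hs hz₀ fun h => by simp [h] at hz).symm
  have hb : Tendsto (cauchyKernel ρ γ l z₀) (comap Complex.re atBot ⊓ 𝓟 {z | |z.im| ≤ Real.pi})
      (𝓝 (((l : ℂ)⁻¹ - (symbol ρ γ l z₀)⁻¹) * 0)) := by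
    have h1 := (((tendsto_inv_symbol_left (γ := γ) hρ0 hl).sub_const
      (symbol ρ γ l z₀)⁻¹).mul hL).mono_left
      (inf_le_left (b := 𝓟 {z : ℂ | |z.im| ≤ Real.pi}))
    refine h1.congr' ?_
    rw [EventuallyEq, eventually_inf_principal]
    filter_upwards [tendsto_comap.eventually (eventually_lt_atBot z₀.re)] with z hz hs
    exact (cauchyKernel_of_ne hρ0 hρ1 hγ hl hs hz₀ fun h => by simp [h] at hz).symm
  have h := tendsto_integral_strip
    (fun z hz => differentiableAt_cauchyKernel hρ0 hρ1 hγ hl hz hz₀) ha hb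
  rw [mul_zero, mul_one, zero_sub, zero_sub, neg_neg] at h
  refine h.congr fun R => intervalIntegral.integral_congr fun x _ => ?_
  have i1 : |((x : ℂ) - Real.pi * Complex.I).im| = Real.pi := by simp [abs_of_pos hpi]
  have i2 : |((x : ℂ) + Real.pi * Complex.I).im| = Real.pi := by simp [abs_of_pos hpi]
  rw [cauchyKernel_of_ne hρ0 hρ1 hγ hl i1.le hz₀ (fun h => by rw [h] at i1; linarith),
    cauchyKernel_of_ne hρ0 hρ1 hγ hl i2.le hz₀ (fun h => by rw [h] at i2; linarith),
    (exp_pm_pi x).1, (exp_pm_pi x).2]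
  have hj := inv_symbol_jump hρ0 hρ1 hγ hl x
  have hd : (-((Real.exp x : ℝ) : ℂ) / (-((Real.exp x : ℝ) : ℂ) - Complex.exp z₀)) =
      (Real.exp x : ℝ) * ((Real.exp x : ℝ) + Complex.exp z₀)⁻¹ := by
    rw [← neg_add', neg_div_neg_eq, div_eq_mul_inv]
  rw [hd, ← sub_mul, sub_sub_sub_cancel_right, hj]
  push_cast
  ring

theorem norm_inv_add_exp_le {r : ℝ} (hr : 0 < r) {s : ℂ} (hs : 0 < s.re) :
    ‖((r : ℂ) + s)⁻¹‖ ≤ s.re⁻¹ := by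
  rw [norm_inv]
  refine inv_anti₀ hs ?_
  calc s.re ≤ ((r : ℂ) + s).re := by simp [hr.le]
    _ ≤ _ := Complex.re_le_norm _

theorem exp_re_pos {z₀ : ℂ} (hz₀ : |z₀.im| < Real.pi / 2) : 0 < (Complex.exp z₀).re := by
  rw [Complex.exp_re]
  rw [abs_lt] at hz₀
  exact mul_pos (Real.exp_pos _) (Real.cos_pos_of_mem_Ioo hz₀)

/-- The Stieltjes transform of the spectral density. -/
theorem stieltjes_spectralDensity (hρ0 : 0 < ρ) (hρ1 : ρ < 1) (hγ : 0 < γ) (hl : 0 < l)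
    {z₀ : ℂ} (hz₀ : |z₀.im| < Real.pi / 2) :
    ∫ r in Ioi (0 : ℝ), (spectralDensity ρ γ l r : ℂ) * ((r : ℂ) + Complex.exp z₀)⁻¹ =
      (symbol ρ γ l z₀)⁻¹ := by
  have hpos := exp_re_pos hz₀
  rw [integral_Ioi_eq_comp_exp, ← integral_eq_of_tendsto ?_
    (tendsto_integral_stieltjes hρ0 hρ1 hγ hl hz₀)]
  · refine integral_congr_ae (ae_of_all _ fun x => ?_)
    simp only [Complex.real_smul]
    push_cast
    ring
  · have hne : ∀ x : ℝ, ((Real.exp x : ℝ) : ℂ) + Complex.exp z₀ ≠ 0 := fun x h => by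
      have := congrArg Complex.re h
      rw [Complex.add_re, Complex.ofReal_re, Complex.zero_re] at this
      have := Real.exp_pos x
      linarith
    refine (integrable_exp_mul_density hρ0 hρ1 hγ hl).ofReal.mul_bdd (c := (Complex.exp z₀).re⁻¹)
      ?_ (ae_of_all _ fun x => norm_inv_add_exp_le (Real.exp_pos x) hpos)
    exact (Continuous.inv₀ (by fun_prop) hne).aestronglyMeasurable

end

/-! ### The relaxation kernel and its Laplace transform -/

section

/-- The Laplace transform of the spectral density, `p(t) = ∫ e^{-rt} q(r) dr`, extended to negative
times by `p(0)`. It is `-l⁻¹` times the derivative of the relaxation function. -/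
def relaxKernel (ρ γ l t : ℝ) : ℝ :=
  ∫ r in Ioi (0 : ℝ), Real.exp (-(r * max t 0)) * spectralDensity ρ γ l r

variable {ρ γ l : ℝ}

theorem integrableOn_exp_mul {q : ℝ → ℝ} (hq : IntegrableOn q (Ioi 0)) {t : ℝ} (ht : 0 ≤ t) :
    IntegrableOn (fun r => Real.exp (-(r * t)) * q r) (Ioi 0) := by
  refine Integrable.bdd_mul (c := 1) hq (by fun_prop) ?_
  refine (ae_restrict_iff' measurableSet_Ioi).2 (ae_of_all _ fun r hr => ?_)
  rw [Real.norm_eq_abs, Real.abs_exp, Real.exp_le_one_iff, neg_nonpos]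
  exact mul_nonneg (le_of_lt hr) ht

theorem relaxKernel_nonneg (hρ0 : 0 < ρ) (hρ1 : ρ < 1) (hγ : 0 < γ) (hl : 0 < l) (t : ℝ) :
    0 ≤ relaxKernel ρ γ l t :=
  setIntegral_nonneg measurableSet_Ioi fun _ hr =>
    mul_nonneg (Real.exp_pos _).le (spectralDensity_pos hρ0 hρ1 hγ hl hr).le

theorem antitone_relaxKernel (hρ0 : 0 < ρ) (hρ1 : ρ < 1) (hγ : 0 < γ) (hl : 0 < l) :
    Antitone (relaxKernel ρ γ l) := by
  intro s t hst
  have hq := integrableOn_spectralDensity hρ0 hρ1 hγ hl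
  refine setIntegral_mono_on (integrableOn_exp_mul hq (le_max_right _ _))
    (integrableOn_exp_mul hq (le_max_right _ _)) measurableSet_Ioi fun r hr => ?_
  refine mul_le_mul_of_nonneg_right ?_ (spectralDensity_pos hρ0 hρ1 hγ hl hr).le
  exact Real.exp_le_exp.2 (neg_le_neg (mul_le_mul_of_nonneg_left (max_le_max_right _ hst)
    (le_of_lt hr)))

theorem relaxKernel_le_one (hρ0 : 0 < ρ) (hρ1 : ρ < 1) (hγ : 0 < γ) (hl : 0 < l) (t : ℝ) :
    relaxKernel ρ γ l t ≤ 1 := by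
  -- At nonpositive times the truncated exponential is 1, leaving the total mass of the density.
  have h0 : relaxKernel ρ γ l (min t 0) = 1 := by
    simp [relaxKernel, integral_spectralDensity hρ0 hρ1 hγ hl]
  exact (antitone_relaxKernel hρ0 hρ1 hγ hl (min_le_left t 0)).trans h0.le

/-- Truncation at time 0 gives continuity on the whole line; the solution built from this kernel is
then differentiable on both sides of every time, as the two-sided `deriv` in `caputoIntegrand`
requires. -/
theorem continuous_relaxKernel (hρ0 : 0 < ρ) (hρ1 : ρ < 1) (hγ : 0 < γ) (hl : 0 < l) :
    Continuous (relaxKernel ρ γ l) := by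
  have hq := integrableOn_spectralDensity hρ0 hρ1 hγ hl
  refine continuous_of_dominated (bound := spectralDensity ρ γ l)
    (fun t => (integrableOn_exp_mul hq (le_max_right _ _)).aestronglyMeasurable) (fun t => ?_) hq
    (ae_of_all _ fun r => by fun_prop)
  refine (ae_restrict_iff' measurableSet_Ioi).2 (ae_of_all _ fun r hr => ?_)
  have hp := (spectralDensity_pos hρ0 hρ1 hγ hl hr).le
  rw [norm_mul, Real.norm_eq_abs, Real.norm_eq_abs, Real.abs_exp, abs_of_nonneg hp]
  refine mul_le_of_le_one_left hp (Real.exp_le_one_iff.2 (neg_nonpos.2 ?_))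
  exact mul_nonneg (le_of_lt hr) (le_max_right _ _)

theorem norm_relaxKernel_le (hρ0 : 0 < ρ) (hρ1 : ρ < 1) (hγ : 0 < γ) (hl : 0 < l) (t : ℝ) :
    ‖relaxKernel ρ γ l t‖ ≤ 1 := by
  rw [Real.norm_of_nonneg (relaxKernel_nonneg hρ0 hρ1 hγ hl t)]
  exact relaxKernel_le_one hρ0 hρ1 hγ hl t

theorem relaxation_eq (ρ γ l t : ℝ) :
    relaxation ρ γ l t =
      l * ∫ r in Ioi (0 : ℝ), Real.exp (-(r * t)) * (spectralDensity ρ γ l r / r) := by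
  rw [relaxation, ← integral_const_mul, ← integral_const_mul]
  refine setIntegral_congr_fun measurableSet_Ioi fun r hr => ?_
  have hr' : r ≠ 0 := ne_of_gt hr
  simp only [spectralDensity]
  rw [Real.rpow_sub_one hr']
  ring

theorem relaxation_nonneg (hρ0 : 0 < ρ) (hρ1 : ρ < 1) (hγ : 0 < γ) (hl : 0 < l) (t : ℝ) :
    0 ≤ relaxation ρ γ l t := by
  rw [relaxation_eq]
  refine mul_nonneg hl.le (setIntegral_nonneg measurableSet_Ioi fun r hr => ?_)
  exact mul_nonneg (Real.exp_pos _).le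
    (div_nonneg (spectralDensity_pos hρ0 hρ1 hγ hl hr).le (le_of_lt hr))

theorem integral_exp_neg_mul (r t : ℝ) (hr : r ≠ 0) :
    ∫ x in (0 : ℝ)..t, Real.exp (-(r * x)) = (1 - Real.exp (-(r * t))) / r := by
  have h : ∀ x ∈ uIcc 0 t, HasDerivAt (fun x => -Real.exp (-(r * x)) / r)
      (Real.exp (-(r * x))) x := by
    intro x _
    have h1 : HasDerivAt (fun x => -(r * x)) (-(r * 1)) x := ((hasDerivAt_id x).const_mul r).neg
    convert! (h1.exp.neg.div_const r) using 1
    field_simp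
  rw [intervalIntegral.integral_eq_sub_of_hasDerivAt h
    ((by fun_prop : Continuous fun x => Real.exp (-(r * x))).intervalIntegrable _ _)]
  simp
  ring

/-- By Fubini, ∫_0^t p is the integral of (1 - e^{-rt}) q(r)/r, and the constant part is the moment
∫ q(r)/r dr = 1/l. -/
theorem relaxation_eq_one_sub (hρ0 : 0 < ρ) (hρ1 : ρ < 1) (hγ : 0 < γ) (hl : 0 < l) {t : ℝ}
    (ht : 0 ≤ t) :
    relaxation ρ γ l t = 1 - l * ∫ x in (0 : ℝ)..t, relaxKernel ρ γ l x := by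
  have hq := integrableOn_spectralDensity hρ0 hρ1 hγ hl
  have hd := integrableOn_spectralDensity_div hρ0 hρ1 hγ hl
  have hswap : ∫ x in (0 : ℝ)..t, relaxKernel ρ γ l x =
      ∫ r in Ioi (0 : ℝ), (∫ x in (0 : ℝ)..t, Real.exp (-(r * x))) * spectralDensity ρ γ l r := by
    simp only [relaxKernel, intervalIntegral.integral_of_le ht]
    rw [integral_integral_swap]
    · refine setIntegral_congr_fun measurableSet_Ioi fun r _ => ?_
      rw [integral_mul_const]
      congr 1
      refine setIntegral_congr_fun measurableSet_Ioc fun x hx => ?_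
      simp only [max_eq_left hx.1.le]
    · have h1 : Integrable (fun z : ℝ × ℝ => (1 : ℝ) * spectralDensity ρ γ l z.2)
          ((volume.restrict (Ioc 0 t)).prod (volume.restrict (Ioi 0))) :=
        Integrable.mul_prod (integrable_const (1 : ℝ)) hq
      simp only [one_mul] at h1
      refine Integrable.bdd_mul (c := 1) h1 (by fun_prop) ?_
      rw [Measure.prod_restrict]
      refine (ae_restrict_iff' (measurableSet_Ioc.prod measurableSet_Ioi)).2
        (ae_of_all _ fun z hz => ?_)
      rw [Real.norm_eq_abs, Real.abs_exp, Real.exp_le_one_iff, neg_nonpos]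
      exact mul_nonneg (le_of_lt hz.2) (le_max_right _ _)
  rw [hswap, relaxation_eq, ← mul_inv_cancel₀ hl.ne', ← mul_sub]
  congr 1
  rw [← integral_spectralDensity_div hρ0 hρ1 hγ hl, eq_sub_iff_add_eq, ← integral_add]
  · refine setIntegral_congr_fun measurableSet_Ioi fun r hr => ?_
    rw [integral_exp_neg_mul r t (ne_of_gt hr)]
    ring
  · exact integrableOn_exp_mul hd ht
  · refine (hd.sub (integrableOn_exp_mul hd ht)).congr_fun (fun r hr => ?_) measurableSet_Ioi
    simp only [Pi.sub_apply]
    rw [integral_exp_neg_mul r t (ne_of_gt hr)]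
    ring

theorem integrableOn_laplace {f : ℝ → ℝ} {c : ℝ}
    (hf : AEStronglyMeasurable f (volume.restrict (Ioi 0)))
    (hb : ∀ t, 0 < t → ‖f t‖ ≤ c) {s : ℂ} (hs : 0 < s.re) :
    IntegrableOn (fun t : ℝ => Complex.exp (-s * t) * (f t : ℂ)) (Ioi 0) := by
  have h1 : IntegrableOn (fun t : ℝ => Complex.exp (-s * t)) (Ioi 0) :=
    integrableOn_exp_mul_complex_Ioi (by simpa using hs) 0
  refine h1.mul_bdd (c := c) (Complex.continuous_ofReal.comp_aestronglyMeasurable hf) ?_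
  refine (ae_restrict_iff' measurableSet_Ioi).2 (ae_of_all _ fun t ht => ?_)
  simpa using hb t ht

/-- The Laplace transform of the kernel is the Stieltjes transform of the spectral density. -/
theorem laplace_relaxKernel (hρ0 : 0 < ρ) (hρ1 : ρ < 1) (hγ : 0 < γ) (hl : 0 < l) {s : ℂ}
    (hs : 0 < s.re) :
    ∫ t in Ioi (0 : ℝ), Complex.exp (-s * t) * (relaxKernel ρ γ l t : ℂ) =
      ∫ r in Ioi (0 : ℝ), (spectralDensity ρ γ l r : ℂ) * ((r : ℂ) + s)⁻¹ := by
  have hq := integrableOn_spectralDensity hρ0 hρ1 hγ hl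
  have h1 : ∀ t ∈ Ioi (0 : ℝ), Complex.exp (-s * t) * (relaxKernel ρ γ l t : ℂ) =
      ∫ r in Ioi (0 : ℝ), Complex.exp (-(r + s) * t) * (spectralDensity ρ γ l r : ℂ) := by
    intro t ht
    rw [relaxKernel, max_eq_left (le_of_lt ht), ← integral_complex_ofReal, ← integral_const_mul]
    refine integral_congr_ae (ae_of_all _ fun r => ?_)
    beta_reduce
    push_cast
    rw [← mul_assoc, ← Complex.exp_add]
    ring_nf
  rw [setIntegral_congr_fun measurableSet_Ioi h1, integral_integral_swap]
  · refine setIntegral_congr_fun measurableSet_Ioi fun r hr => ?_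
    have hre : (-((r : ℂ) + s)).re < 0 := by
      have : 0 < r := hr
      simp
      linarith
    rw [integral_mul_const, integral_exp_mul_complex_Ioi hre]
    simp only [Complex.ofReal_zero, mul_zero, Complex.exp_zero, neg_div_neg_eq, one_div]
    ring
  · have h2 : Integrable (fun z : ℝ × ℝ => Complex.exp (-s * z.1) * (spectralDensity ρ γ l z.2 : ℂ))
        ((volume.restrict (Ioi 0)).prod (volume.restrict (Ioi 0))) :=
      Integrable.mul_prod (f := fun t : ℝ => Complex.exp (-s * t))
        (g := fun r => (spectralDensity ρ γ l r : ℂ))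
        (integrableOn_exp_mul_complex_Ioi (by simpa using hs) 0) hq.ofReal
    have h3 : Integrable (fun z : ℝ × ℝ => (Real.exp (-(z.2 * z.1)) : ℂ) *
        (Complex.exp (-s * z.1) * (spectralDensity ρ γ l z.2 : ℂ)))
        ((volume.restrict (Ioi 0)).prod (volume.restrict (Ioi 0))) := by
      refine Integrable.bdd_mul (c := 1) h2 (by fun_prop) ?_
      rw [Measure.prod_restrict]
      refine (ae_restrict_iff' (measurableSet_Ioi.prod measurableSet_Ioi)).2
        (ae_of_all _ fun z hz => ?_)
      rw [Complex.norm_real, Real.norm_eq_abs, Real.abs_exp, Real.exp_le_one_iff, neg_nonpos]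
      exact mul_nonneg (le_of_lt hz.2) (le_of_lt hz.1)
    refine h3.congr (ae_of_all _ fun z => ?_)
    simp only [Function.uncurry]
    push_cast
    rw [← mul_assoc, ← Complex.exp_add]
    ring_nf

end

/-! ### Laplace transforms of powers and injectivity of the Laplace transform -/

section

theorem integrableOn_rpow_mul_exp {a c : ℝ} (ha : 0 < a) (hc : 0 < c) :
    IntegrableOn (fun t : ℝ => t ^ (a - 1) * Real.exp (-c * t)) (Ioi 0) := by
  have h := integrableOn_rpow_mul_exp_neg_mul_rpow (s := a - 1) (p := 1) (b := c) (by linarith)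
    (by norm_num) hc
  simpa using h

theorem norm_exp_mul_rpow {a t : ℝ} (ht : 0 < t) (s : ℂ) :
    ‖Complex.exp (-s * t) * ((t ^ a : ℝ) : ℂ)‖ = t ^ a * Real.exp (-s.re * t) := by
  rw [norm_mul, Complex.norm_exp, Complex.norm_real, Real.norm_of_nonneg (Real.rpow_nonneg ht.le _)]
  simp [mul_comm]

theorem aestronglyMeasurable_exp_mul_rpow (a : ℝ) (s : ℂ) :
    AEStronglyMeasurable (fun t : ℝ => Complex.exp (-s * t) * ((t ^ a : ℝ) : ℂ))
      (volume.restrict (Ioi 0)) :=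
  (by fun_prop : Measurable fun t : ℝ =>
    Complex.exp (-s * t) * ((t ^ a : ℝ) : ℂ)).aestronglyMeasurable

theorem integrableOn_exp_mul_rpow {a : ℝ} (ha : 0 < a) {s : ℂ} (hs : 0 < s.re) :
    IntegrableOn (fun t : ℝ => Complex.exp (-s * t) * ((t ^ (a - 1) : ℝ) : ℂ)) (Ioi 0) := by
  refine (integrableOn_rpow_mul_exp ha hs).mono' (aestronglyMeasurable_exp_mul_rpow _ _)
    ((ae_restrict_iff' measurableSet_Ioi).2 (ae_of_all _ fun t ht => ?_))
  rw [norm_exp_mul_rpow ht]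

theorem differentiableAt_laplace_rpow {a : ℝ} (ha : 0 < a) {s : ℂ} (hs : 0 < s.re) :
    DifferentiableAt ℂ
      (fun s : ℂ => ∫ t in Ioi (0 : ℝ), Complex.exp (-s * t) * ((t ^ (a - 1) : ℝ) : ℂ)) s := by
  have hs2 : 0 < s.re / 2 := by linarith
  refine (hasDerivAt_integral_of_dominated_loc_of_deriv_le
    (F := fun (w : ℂ) (t : ℝ) => Complex.exp (-w * t) * ((t ^ (a - 1) : ℝ) : ℂ))
    (F' := fun (w : ℂ) (t : ℝ) => -(Complex.exp (-w * t) * ((t ^ a : ℝ) : ℂ)))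
    (bound := fun t => t ^ a * Real.exp (-(s.re / 2) * t))
    (Metric.ball_mem_nhds s hs2)
    (Eventually.of_forall fun w => aestronglyMeasurable_exp_mul_rpow _ w)
    (integrableOn_exp_mul_rpow ha hs) (aestronglyMeasurable_exp_mul_rpow _ _).neg
    ((ae_restrict_iff' measurableSet_Ioi).2 (ae_of_all _ fun t ht w hw => ?_))
    (by simpa [IntegrableOn] using integrableOn_rpow_mul_exp (a := a + 1) (by linarith) hs2)
    ((ae_restrict_iff' measurableSet_Ioi).2 (ae_of_all _ fun t ht w hw => ?_))).2.differentiableAt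
  · have ht' : 0 < t := ht
    rw [norm_neg, norm_exp_mul_rpow ht]
    refine mul_le_mul_of_nonneg_left (Real.exp_le_exp.2 ?_) (Real.rpow_nonneg ht'.le _)
    refine mul_le_mul_of_nonneg_right (neg_le_neg ?_) ht'.le
    have h1 := (Complex.abs_re_le_norm (w - s)).trans_lt (mem_ball_iff_norm.1 hw)
    rw [Complex.sub_re, abs_lt] at h1
    linarith
  · have ht' : 0 < t := ht
    have h1 : HasDerivAt (fun w : ℂ => -w * t) (-1 * t) w := (hasDerivAt_id w).neg.mul_const _
    convert! h1.cexp.mul_const ((t ^ (a - 1) : ℝ) : ℂ) using 1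
    rw [Real.rpow_sub_one ht'.ne']
    push_cast
    have : (t : ℂ) ≠ 0 := by exact_mod_cast ht'.ne'
    field_simp

/-- The Laplace transform of a power, on the whole right half-plane. -/
theorem laplace_rpow {a : ℝ} (ha : 0 < a) {s : ℂ} (hs : 0 < s.re) :
    ∫ t in Ioi (0 : ℝ), Complex.exp (-s * t) * ((t ^ (a - 1) : ℝ) : ℂ) =
      Real.Gamma a * Complex.exp (-a * Complex.log s) := by
  have ho : IsOpen {s : ℂ | 0 < s.re} := isOpen_lt continuous_const Complex.continuous_re
  have h1 : AnalyticOnNhd ℂ (fun s : ℂ => ∫ t in Ioi (0 : ℝ),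
      Complex.exp (-s * t) * ((t ^ (a - 1) : ℝ) : ℂ)) {s : ℂ | 0 < s.re} :=
    DifferentiableOn.analyticOnNhd
      (fun s hs => (differentiableAt_laplace_rpow ha hs).differentiableWithinAt) ho
  have h2 : AnalyticOnNhd ℂ (fun s : ℂ => Real.Gamma a * Complex.exp (-a * Complex.log s))
      {s : ℂ | 0 < s.re} :=
    DifferentiableOn.analyticOnNhd (fun s hs => DifferentiableAt.differentiableWithinAt
      (((Complex.differentiableAt_log (Or.inl hs)).const_mul _).cexp.const_mul _)) ho
  have hconn : IsPreconnected {s : ℂ | 0 < s.re} := (convex_halfSpace_re_gt 0).isPreconnected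
  have hreal : ∀ r : ℝ, 0 < r → ∫ t in Ioi (0 : ℝ), Complex.exp (-(r : ℂ) * t) *
      ((t ^ (a - 1) : ℝ) : ℂ) = Real.Gamma a * Complex.exp (-a * Complex.log r) := by
    intro r hr
    have h3 := Real.integral_rpow_mul_exp_neg_mul_Ioi ha hr
    have h4 : ∫ t in Ioi (0 : ℝ), Complex.exp (-(r : ℂ) * t) * ((t ^ (a - 1) : ℝ) : ℂ) =
        ((∫ t in Ioi (0 : ℝ), t ^ (a - 1) * Real.exp (-(r * t)) : ℝ) : ℂ) := by
      rw [← integral_complex_ofReal]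
      refine integral_congr_ae (ae_of_all _ fun t => ?_)
      push_cast
      ring_nf
    rw [h4, h3, one_div, Real.inv_rpow hr.le, ← Real.rpow_neg hr.le, Real.rpow_def_of_pos hr,
      ← Complex.ofReal_log hr.le]
    push_cast
    ring_nf
  -- Identity theorem: both sides are analytic in the right half-plane and agree on the positive
  -- reals, which accumulate at 1.
  refine h1.eqOn_of_preconnected_of_frequently_eq h2 hconn (z₀ := 1) (by simp) ?_ hs
  have ht : Tendsto (fun r : ℝ => (r : ℂ)) (𝓝[≠] 1) (𝓝[≠] 1) := by
    refine tendsto_nhdsWithin_iff.2 ⟨?_, ?_⟩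
    · exact (Complex.continuous_ofReal.tendsto' 1 1 (by simp)).mono_left nhdsWithin_le_nhds
    · filter_upwards [self_mem_nhdsWithin] with r hr
      simpa using hr
  refine ht.frequently (Eventually.frequently ?_)
  filter_upwards [nhdsWithin_le_nhds (lt_mem_nhds (show (0 : ℝ) < 1 by norm_num))] with r hr
  exact hreal r hr

/-- **Injectivity of the Laplace transform**: a function whose Laplace transform vanishes on the
line `Re s = 1` vanishes at every positive point of continuity. -/
theorem eq_zero_of_laplace_eq_zero {f : ℝ → ℂ}
    (hi : IntegrableOn (fun t : ℝ => Complex.exp (-t) * f t) (Ioi 0))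
    (h0 : ∀ s : ℂ, s.re = 1 → ∫ t in Ioi (0 : ℝ), Complex.exp (-s * t) * f t = 0)
    {t : ℝ} (ht : 0 < t) (hc : ContinuousAt f t) : f t = 0 := by
  -- The Laplace transform of `f` along Re s = 1 is, up to scaling, the Fourier transform of this
  -- `g`. It vanishes, hence is integrable, and Fourier inversion applies at points of continuity.
  set g : ℝ → ℂ := (Ioi (0 : ℝ)).indicator fun t : ℝ => Complex.exp (-t) * f t with hg
  have hgi : Integrable g := (integrable_indicator_iff measurableSet_Ioi).2 hi
  have hF : FourierTransform.fourier g = 0 := by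
    ext w
    rw [Real.fourier_real_eq_integral_exp_smul]
    simp only [Pi.zero_apply]
    rw [← h0 (1 + 2 * Real.pi * w * Complex.I) (by simp), ← integral_indicator measurableSet_Ioi]
    refine integral_congr_ae (ae_of_all _ fun x => ?_)
    beta_reduce
    rw [hg]
    by_cases hx : x ∈ Ioi (0 : ℝ)
    · rw [indicator_of_mem hx, indicator_of_mem hx, smul_eq_mul, ← mul_assoc, ← Complex.exp_add]
      push_cast
      ring_nf
    · rw [indicator_of_notMem hx, indicator_of_notMem hx, smul_zero]
  have hev : g =ᶠ[𝓝 t] fun t : ℝ => Complex.exp (-t) * f t := by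
    filter_upwards [lt_mem_nhds ht] with x hx
    exact indicator_of_mem (show x ∈ Ioi (0 : ℝ) from hx) _
  have hgc : ContinuousAt g t := by
    refine ContinuousAt.congr ?_ hev.symm
    exact ContinuousAt.mul (by fun_prop) hc
  have h1 := hgi.fourierInv_fourier_eq (by rw [hF]; exact integrable_zero _ _ _) hgc
  rw [hF, hev.eq_of_nhds] at h1
  have h2 : FourierTransformInv.fourierInv (0 : ℝ → ℂ) t = 0 := by
    rw [Real.fourierInv_eq']
    simp
  rw [h2] at h1
  exact (mul_eq_zero.1 h1.symm).resolve_left (Complex.exp_ne_zero _)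

end

/-! ### The Volterra equation for the relaxation kernel -/

section

/-- The kernel of the Volterra equation solved by `relaxKernel`. -/
def volterraKernel (ρ γ l x : ℝ) : ℝ :=
  l * x ^ ((1 : ℝ) - 1) + l * γ / Real.Gamma (1 - ρ) * x ^ ((1 - ρ) - 1)

variable {ρ γ l : ℝ}

theorem intervalIntegrable_volterraKernel (hρ1 : ρ < 1) (a b : ℝ) :
    IntervalIntegrable (volterraKernel ρ γ l) volume a b :=
  ((intervalIntegral.intervalIntegrable_rpow' (by norm_num)).const_mul _).add
    ((intervalIntegral.intervalIntegrable_rpow' (by linarith)).const_mul _)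

/-- Separates the powers t^{a-1} with a = 1 and a = 1 - ρ, in the form that `laplace_rpow` takes;
this is why the exponents in `volterraKernel` are left unsimplified. -/
theorem exp_mul_volterraKernel (ρ γ l t : ℝ) (s : ℂ) :
    Complex.exp (-s * t) * (volterraKernel ρ γ l t : ℂ) =
      l * (Complex.exp (-s * t) * ((t ^ ((1 : ℝ) - 1) : ℝ) : ℂ)) +
        (l * γ / Real.Gamma (1 - ρ) : ℝ) *
          (Complex.exp (-s * t) * ((t ^ ((1 - ρ) - 1) : ℝ) : ℂ)) := by
  rw [volterraKernel, Complex.ofReal_add, Complex.ofReal_mul, Complex.ofReal_mul]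
  ring

theorem integrableOn_exp_mul_volterraKernel (hρ1 : ρ < 1) {s : ℂ} (hs : 0 < s.re) :
    IntegrableOn (fun t : ℝ => Complex.exp (-s * t) * (volterraKernel ρ γ l t : ℂ)) (Ioi 0) := by
  simp only [exp_mul_volterraKernel]
  exact ((integrableOn_exp_mul_rpow one_pos hs).const_mul _).add
    ((integrableOn_exp_mul_rpow (by linarith) hs).const_mul _)

theorem laplace_volterraKernel (hρ1 : ρ < 1) {s : ℂ} (hs : 0 < s.re) :
    ∫ t in Ioi (0 : ℝ), Complex.exp (-s * t) * (volterraKernel ρ γ l t : ℂ) =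
      l * Complex.exp (-Complex.log s) + l * γ * Complex.exp ((ρ - 1) * Complex.log s) := by
  simp only [exp_mul_volterraKernel]
  rw [integral_add ((integrableOn_exp_mul_rpow one_pos hs).const_mul _)
    ((integrableOn_exp_mul_rpow (by linarith) hs).const_mul _), integral_const_mul,
    integral_const_mul, laplace_rpow one_pos hs, laplace_rpow (by linarith) hs]
  have hΓ : (Real.Gamma (1 - ρ) : ℂ) ≠ 0 := by
    exact_mod_cast (Real.Gamma_pos_of_pos (by linarith)).ne'
  rw [Real.Gamma_one]
  push_cast
  field_simp
  ring_nf

/-- The convolution of the Volterra kernel with `relaxKernel`. -/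
def volterraConv (ρ γ l t : ℝ) : ℝ :=
  ∫ x in (0 : ℝ)..t, volterraKernel ρ γ l x * relaxKernel ρ γ l (t - x)

/-- Needed because injectivity of the Laplace transform gives equality only at points of continuity.
The time enters both as upper limit and as parameter, so joint continuity is restricted to the
diagonal. -/
theorem continuousAt_volterraConv (hρ0 : 0 < ρ) (hρ1 : ρ < 1) (hγ : 0 < γ) (hl : 0 < l) {t : ℝ}
    (ht : 0 < t) : ContinuousAt (volterraConv ρ γ l) t := by
  have hp := continuous_relaxKernel hρ0 hρ1 hγ hl
  have hk := intervalIntegrable_volterraKernel (γ := γ) (l := l) hρ1 (-1) (t + 1)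
  have hm : AEStronglyMeasurable (volterraKernel ρ γ l) (volume.restrict (uIoc (-1) (t + 1))) :=
    hk.def'.aestronglyMeasurable
  have h := intervalIntegral.continuousAt_parametric_primitive_of_dominated (μ := volume)
    (F := fun t x => volterraKernel ρ γ l x * relaxKernel ρ γ l (t - x))
    (fun x => ‖volterraKernel ρ γ l x‖) (-1) (t + 1) (a₀ := 0) (b₀ := t) (x₀ := t)
    (fun u => hm.mul (hp.comp (by fun_prop : Continuous fun x => u - x)).aestronglyMeasurable)
    (Eventually.of_forall fun u => ae_of_all _ fun x => by
      rw [norm_mul]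
      exact mul_le_of_le_one_right (norm_nonneg _) (norm_relaxKernel_le hρ0 hρ1 hγ hl _))
    hk.norm (ae_of_all _ fun x => by fun_prop) (by constructor <;> linarith)
    (by constructor <;> linarith) (by simp)
  exact ContinuousAt.comp (f := fun u : ℝ => (u, u))
    (g := fun z : ℝ × ℝ => ∫ x in (0 : ℝ)..z.2,
      volterraKernel ρ γ l x * relaxKernel ρ γ l (z.1 - x)) h (by fun_prop)

theorem exp_mul_volterraConv (ρ γ l t : ℝ) (s : ℂ) :
    Complex.exp (-s * t) * (volterraConv ρ γ l t : ℂ) =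
      ∫ x in (0 : ℝ)..t, ContinuousLinearMap.mul ℝ ℂ
        (Complex.exp (-s * x) * (volterraKernel ρ γ l x : ℂ))
        (Complex.exp (-s * (t - x : ℝ)) * (relaxKernel ρ γ l (t - x) : ℂ)) := by
  rw [volterraConv, ← intervalIntegral.integral_ofReal, ← intervalIntegral.integral_const_mul]
  refine intervalIntegral.integral_congr fun x _ => ?_
  have h : Complex.exp (-s * t) = Complex.exp (-s * x) * Complex.exp (-s * (t - x : ℝ)) := by
    rw [← Complex.exp_add]
    push_cast
    ring_nf
  simp only [ContinuousLinearMap.mul_apply']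
  rw [h]
  push_cast
  ring

/-- With S(s) = s + lγs^ρ + l, the kernel `relaxKernel` has transform 1/S and the Volterra kernel
has transform l/s + lγs^{ρ-1} = S/s - 1. The left side therefore has transform (S/s)(1/S) = 1/s,
that of the constant 1. -/
theorem relaxKernel_add_volterraConv (hρ0 : 0 < ρ) (hρ1 : ρ < 1) (hγ : 0 < γ) (hl : 0 < l)
    {t : ℝ} (ht : 0 < t) : relaxKernel ρ γ l t + volterraConv ρ γ l t = 1 := by
  have hp := continuous_relaxKernel hρ0 hρ1 hγ hl
  have ip : ∀ s : ℂ, 0 < s.re →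
      IntegrableOn (fun t : ℝ => Complex.exp (-s * t) * (relaxKernel ρ γ l t : ℂ)) (Ioi 0) :=
    fun s hs => integrableOn_laplace hp.aestronglyMeasurable
      (fun t _ => norm_relaxKernel_le hρ0 hρ1 hγ hl t) hs
  have ic : ∀ s : ℂ, 0 < s.re →
      IntegrableOn (fun t : ℝ => Complex.exp (-s * t) * (volterraConv ρ γ l t : ℂ)) (Ioi 0) := by
    intro s hs
    have h := (integrable_posConvolution (integrableOn_exp_mul_volterraKernel (γ := γ) (l := l)
      hρ1 hs) (ip s hs) (ContinuousLinearMap.mul ℝ ℂ)).integrableOn (s := Ioi 0)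
    refine h.congr_fun (fun t ht => ?_) measurableSet_Ioi
    rw [posConvolution, indicator_of_mem ht, exp_mul_volterraConv]
  have i1 : ∀ s : ℂ, 0 < s.re → IntegrableOn (fun t : ℝ => Complex.exp (-s * t)) (Ioi 0) :=
    fun s hs => integrableOn_exp_mul_complex_Ioi (by simpa using hs) 0
  have isum : ∀ s : ℂ, 0 < s.re → IntegrableOn (fun t : ℝ => Complex.exp (-s * t) *
      (((relaxKernel ρ γ l t + volterraConv ρ γ l t - 1 : ℝ)) : ℂ)) (Ioi 0) := by
    intro s hs
    refine (((ip s hs).add (ic s hs)).sub (i1 s hs)).congr_fun (fun t _ => ?_) measurableSet_Ioi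
    simp only [Pi.add_apply, Pi.sub_apply]
    push_cast
    ring
  have key := eq_zero_of_laplace_eq_zero
    (f := fun t => ((relaxKernel ρ γ l t + volterraConv ρ γ l t - 1 : ℝ) : ℂ))
    (by simpa using isum 1 (by simp)) (fun s hs => ?_) ht
    (Complex.continuous_ofReal.continuousAt.comp
      ((hp.continuousAt.add (continuousAt_volterraConv hρ0 hρ1 hγ hl ht)).sub continuousAt_const))
  · have : relaxKernel ρ γ l t + volterraConv ρ γ l t - 1 = 0 := by exact_mod_cast key
    linarith
  · have hs0 : 0 < s.re := by rw [hs]; exact one_pos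
    have hne : s ≠ 0 := fun h => by simp [h] at hs0
    have hz : |(Complex.log s).im| < Real.pi / 2 := by
      rw [Complex.log_im]
      exact Complex.abs_arg_lt_pi_div_two_iff.2 (Or.inl hs0)
    have hP := stieltjes_spectralDensity hρ0 hρ1 hγ hl hz
    rw [Complex.exp_log hne, ← laplace_relaxKernel hρ0 hρ1 hγ hl hs0] at hP
    have hC : ∫ t in Ioi (0 : ℝ), Complex.exp (-s * t) * (volterraConv ρ γ l t : ℂ) =
        (l * Complex.exp (-Complex.log s) + l * γ * Complex.exp ((ρ - 1) * Complex.log s)) *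
          (symbol ρ γ l (Complex.log s))⁻¹ := by
      rw [← hP, ← laplace_volterraKernel hρ1 hs0]
      rw [← ContinuousLinearMap.mul_apply' ℝ ℂ, ← integral_posConvolution
        (integrableOn_exp_mul_volterraKernel hρ1 hs0) (ip s hs0)]
      exact setIntegral_congr_fun measurableSet_Ioi fun t _ => exp_mul_volterraConv ρ γ l t s
    have h1 : ∫ t in Ioi (0 : ℝ), Complex.exp (-s * t) = s⁻¹ := by
      rw [integral_exp_mul_complex_Ioi (by simpa using hs0)]
      simp
    have hsplit : ∫ t in Ioi (0 : ℝ), Complex.exp (-s * t) *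
        (((relaxKernel ρ γ l t + volterraConv ρ γ l t - 1 : ℝ)) : ℂ) =
        (symbol ρ γ l (Complex.log s))⁻¹ + (l * Complex.exp (-Complex.log s) +
          l * γ * Complex.exp ((ρ - 1) * Complex.log s)) * (symbol ρ γ l (Complex.log s))⁻¹ -
          s⁻¹ := by
      have h2 := integral_sub ((ip s hs0).add (ic s hs0)) (i1 s hs0)
      rw [integral_add' (ip s hs0) (ic s hs0), hP, hC, h1] at h2
      rw [← h2]
      refine setIntegral_congr_fun measurableSet_Ioi fun t _ => ?_
      simp only [Pi.add_apply]
      push_cast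
      ring
    rw [hsplit]
    have hsym := symbol_ne_zero hρ0 hρ1 hγ hl (z := Complex.log s)
      (by linarith [Real.pi_pos])
    have e1 : Complex.exp (-Complex.log s) = s⁻¹ := by rw [Complex.exp_neg, Complex.exp_log hne]
    have e2 : Complex.exp ((ρ - 1) * Complex.log s) = Complex.exp (ρ * Complex.log s) * s⁻¹ := by
      rw [← e1, ← Complex.exp_add]; ring_nf
    have e3 : symbol ρ γ l (Complex.log s) = s + l * γ * Complex.exp (ρ * Complex.log s) + l := by
      rw [symbol, Complex.exp_log hne]
    rw [e1, e2]
    field_simp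
    rw [e3]
    ring

theorem intervalIntegrable_caputoWeight (hρ1 : ρ < 1) {t : ℝ} (ht : 0 ≤ t) :
    IntervalIntegrable (fun x => ((t - x) ^ ρ)⁻¹) volume 0 t := by
  have h2 := (intervalIntegral.intervalIntegrable_rpow' (r := -ρ) (by linarith)
    (a := 0) (b := t)).comp_sub_left t
  simp only [sub_zero, sub_self] at h2
  refine (h2.symm).congr fun x hx => ?_
  rw [uIoc_of_le ht] at hx
  exact Real.rpow_neg (by linarith [hx.2]) ρ

/-- The Volterra equation for the relaxation kernel, in terms of its fractional integral. -/
theorem relaxKernel_volterra (hρ0 : 0 < ρ) (hρ1 : ρ < 1) (hγ : 0 < γ) (hl : 0 < l)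
    {t : ℝ} (ht : 0 < t) :
    relaxKernel ρ γ l t + l * (∫ x in (0 : ℝ)..t, relaxKernel ρ γ l x) +
      l * γ * ((Real.Gamma (1 - ρ))⁻¹ *
        ∫ x in (0 : ℝ)..t, ((t - x) ^ ρ)⁻¹ * relaxKernel ρ γ l x) = 1 := by
  have hp := continuous_relaxKernel hρ0 hρ1 hγ hl
  refine Eq.trans ?_ (relaxKernel_add_volterraConv hρ0 hρ1 hγ hl ht)
  rw [add_assoc]
  congr 1
  have h1 : volterraConv ρ γ l t =
      ∫ x in (0 : ℝ)..t, volterraKernel ρ γ l (t - x) * relaxKernel ρ γ l x := by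
    have h := intervalIntegral.integral_comp_sub_left (a := 0) (b := t)
      (fun x => volterraKernel ρ γ l x * relaxKernel ρ γ l (t - x)) t
    simp only [sub_sub_cancel, sub_self, sub_zero] at h
    rw [h, volterraConv]
  have hint := intervalIntegrable_caputoWeight hρ1 ht.le
  rw [h1, ← mul_assoc, ← intervalIntegral.integral_const_mul,
    ← intervalIntegral.integral_const_mul, ← intervalIntegral.integral_add
    ((hp.intervalIntegrable _ _).const_mul _) ((hint.mul_continuousOn hp.continuousOn).const_mul _)]
  refine intervalIntegral.integral_congr fun x hx => ?_
  rw [uIcc_of_le ht.le] at hx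
  have e : (1 - ρ) - 1 = -ρ := by ring
  simp only [volterraKernel, e, sub_self, Real.rpow_zero,
    Real.rpow_neg (show 0 ≤ t - x by linarith [hx.2])]
  ring

end

/-! ### Uniform estimates for the relaxation function and the coefficients -/

section

variable {ρ γ l : ℝ}

theorem integral_caputoWeight (hρ1 : ρ < 1) {t : ℝ} (ht : 0 ≤ t) :
    ∫ x in (0 : ℝ)..t, ((t - x) ^ ρ)⁻¹ = t ^ (1 - ρ) / (1 - ρ) := by
  rw [intervalIntegral.integral_comp_sub_left (fun x => (x ^ ρ)⁻¹) t, sub_self, sub_zero]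
  have h : ∫ x in (0 : ℝ)..t, (x ^ ρ)⁻¹ = ∫ x in (0 : ℝ)..t, x ^ (-ρ) := by
    refine intervalIntegral.integral_congr fun x hx => ?_
    rw [uIcc_of_le ht] at hx
    exact (Real.rpow_neg hx.1 ρ).symm
  rw [h, integral_rpow (Or.inl (by linarith)), Real.zero_rpow (by linarith)]
  ring_nf

/-- **Chebyshev's inequality** for a decreasing function against the increasing Caputo weight. -/
theorem integral_caputoWeight_mul_le (hρ0 : 0 < ρ) (hρ1 : ρ < 1) {t : ℝ} (ht : 0 < t) {p : ℝ → ℝ}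
    (hp : Continuous p) (ha : Antitone p) :
    ∫ x in (0 : ℝ)..t, ((t - x) ^ ρ)⁻¹ * p x ≤
      t ^ (-ρ) / (1 - ρ) * ∫ x in (0 : ℝ)..t, p x := by
  have hw := intervalIntegrable_caputoWeight hρ1 ht.le
  have h1ρ : 0 < 1 - ρ := by linarith
  -- κ is the mean of the weight over (0, t), and t - y below is the point where the increasing
  -- weight crosses it. On either side of that point, weight minus κ and p minus p(t - y) have
  -- opposite signs; the product integrates to at most 0, and the term with p(t - y) drops out.
  set κ : ℝ := t ^ (-ρ) / (1 - ρ) with hκ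
  have hκ0 : 0 < κ := by positivity
  set y : ℝ := κ⁻¹ ^ ρ⁻¹ with hy
  have hy0 : 0 < y := by positivity
  have hyρ : y ^ ρ = κ⁻¹ := by rw [hy, Real.rpow_inv_rpow (by positivity) hρ0.ne']
  have hpt : ∀ x ∈ Ioo 0 t, (((t - x) ^ ρ)⁻¹ - κ) * (p x - p (t - y)) ≤ 0 := by
    intro x hx
    have htx : 0 < t - x := by linarith [hx.2]
    have hpow : 0 < (t - x) ^ ρ := by positivity
    rcases le_total y (t - x) with h | h
    · have h1 : ((t - x) ^ ρ)⁻¹ ≤ κ := by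
        rw [← inv_inv κ, ← hyρ]
        exact inv_anti₀ (by positivity) (Real.rpow_le_rpow hy0.le h hρ0.le)
      exact mul_nonpos_of_nonpos_of_nonneg (by linarith)
        (sub_nonneg.2 (ha (by linarith)))
    · have h1 : κ ≤ ((t - x) ^ ρ)⁻¹ := by
        rw [← inv_inv κ, ← hyρ]
        exact inv_anti₀ hpow (Real.rpow_le_rpow htx.le h hρ0.le)
      exact mul_nonpos_of_nonneg_of_nonpos (by linarith)
        (sub_nonpos.2 (ha (by linarith)))
  have i1 := hw.mul_continuousOn hp.continuousOn
  have i2 := (hp.intervalIntegrable (μ := volume) 0 t).const_mul κ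
  have i3 := hw.mul_const (p (t - y))
  have i4 : IntervalIntegrable (fun _ : ℝ => κ * p (t - y)) volume 0 t := intervalIntegrable_const
  have hκt : κ * t = t ^ (1 - ρ) / (1 - ρ) := by
    rw [hκ, show (1 - ρ) = -ρ + 1 by ring, Real.rpow_add_one ht.ne']
    ring
  have hmono := intervalIntegral.integral_mono_on_of_le_Ioo ht.le (i1.sub i2) (i3.sub i4)
    (fun x hx => by
      have := hpt x hx
      nlinarith)
  rw [intervalIntegral.integral_sub i1 i2, intervalIntegral.integral_sub i3 i4,
    intervalIntegral.integral_const_mul, intervalIntegral.integral_mul_const,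
    integral_caputoWeight hρ1 ht.le, intervalIntegral.integral_const, ← hκt] at hmono
  simp only [sub_zero, smul_eq_mul] at hmono
  nlinarith

theorem integral_relaxKernel_nonneg (hρ0 : 0 < ρ) (hρ1 : ρ < 1) (hγ : 0 < γ) (hl : 0 < l)
    {t : ℝ} (ht : 0 ≤ t) : 0 ≤ ∫ x in (0 : ℝ)..t, relaxKernel ρ γ l x :=
  intervalIntegral.integral_nonneg ht fun x _ => relaxKernel_nonneg hρ0 hρ1 hγ hl x

theorem relaxation_le_one (hρ0 : 0 < ρ) (hρ1 : ρ < 1) (hγ : 0 < γ) (hl : 0 < l)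
    {t : ℝ} (ht : 0 ≤ t) : relaxation ρ γ l t ≤ 1 := by
  rw [relaxation_eq_one_sub hρ0 hρ1 hγ hl ht]
  have := mul_nonneg hl.le (integral_relaxKernel_nonneg hρ0 hρ1 hγ hl ht)
  linarith

/-- A lower bound for `1 - A_ρ(l, T)`, uniform in `l ≥ l₁`. -/
def relaxationGap (ρ γ l₁ T : ℝ) : ℝ :=
  l₁ / (T⁻¹ + l₁ * (1 + γ * (Real.Gamma (1 - ρ))⁻¹ * (T ^ (-ρ) / (1 - ρ))))

theorem relaxationGap_pos (hρ1 : ρ < 1) (hγ : 0 < γ) {l₁ T : ℝ} (hl₁ : 0 < l₁) (hT : 0 < T) :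
    0 < relaxationGap ρ γ l₁ T := by
  have h1 : 0 < 1 - ρ := by linarith
  have := Real.Gamma_pos_of_pos h1
  unfold relaxationGap
  positivity

/-- Let M = ∫_0^T p. In the Volterra equation at T, monotonicity gives p(T) ≤ M/T and Chebyshev's
inequality bounds the fractional integral by a multiple of M, so 1 ≤ M(1/T + lc). Hence 1 - A_ρ(l,
T) = lM ≥ l/(1/T + lc), which increases with l. -/
theorem relaxationGap_le (hρ0 : 0 < ρ) (hρ1 : ρ < 1) (hγ : 0 < γ) {l₁ T : ℝ} (hl₁ : 0 < l₁)
    (hT : 0 < T) (h : l₁ ≤ l) : relaxationGap ρ γ l₁ T ≤ 1 - relaxation ρ γ l T := by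
  have hl : 0 < l := hl₁.trans_le h
  have h1 : 0 < 1 - ρ := by linarith
  have hΓ := Real.Gamma_pos_of_pos h1
  have hp := continuous_relaxKernel hρ0 hρ1 hγ hl
  have ha := antitone_relaxKernel hρ0 hρ1 hγ hl
  set c : ℝ := 1 + γ * (Real.Gamma (1 - ρ))⁻¹ * (T ^ (-ρ) / (1 - ρ)) with hc
  have hc0 : 0 < c := by positivity
  set M : ℝ := ∫ x in (0 : ℝ)..T, relaxKernel ρ γ l x with hM
  have hpT : relaxKernel ρ γ l T ≤ T⁻¹ * M := by
    have h2 := intervalIntegral.integral_mono_on hT.le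
      (intervalIntegrable_const (c := relaxKernel ρ γ l T))
      (hp.intervalIntegrable (μ := volume) 0 T) (fun x hx => ha hx.2)
    rw [intervalIntegral.integral_const, sub_zero, smul_eq_mul] at h2
    rw [inv_mul_eq_div, le_div_iff₀ hT]
    linarith
  have hV := relaxKernel_volterra hρ0 hρ1 hγ hl hT
  have hC := integral_caputoWeight_mul_le hρ0 hρ1 hT hp ha
  have h3 : 1 ≤ M * (T⁻¹ + l * c) := by
    have h4 := mul_le_mul_of_nonneg_left hC
      (show 0 ≤ l * γ * (Real.Gamma (1 - ρ))⁻¹ by positivity)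
    rw [hc]
    nlinarith
  have hM0 : 0 ≤ M := integral_relaxKernel_nonneg hρ0 hρ1 hγ hl hT.le
  rw [relaxation_eq_one_sub hρ0 hρ1 hγ hl hT.le, sub_sub_cancel, relaxationGap, ← hc,
    div_le_iff₀ (by positivity)]
  have h5 : l₁ * T⁻¹ ≤ l * T⁻¹ := mul_le_mul_of_nonneg_right h (by positivity)
  have h6 := mul_le_mul_of_nonneg_left h3 hl₁.le
  have h7 := mul_le_mul_of_nonneg_left h5 hM0
  nlinarith

/-- The coefficient `A_ρ(l, t) / (A_ρ(l, T) - 1)` of the solution. -/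
def coeff (ρ γ T l t : ℝ) : ℝ := relaxation ρ γ l t / (relaxation ρ γ l T - 1)

/-- The derivative of `coeff`, divided by `l`. -/
def coeffDeriv (ρ γ T l t : ℝ) : ℝ := relaxKernel ρ γ l t / (1 - relaxation ρ γ l T)

/-- The Caputo derivative of `coeff`. -/
def coeffCaputo (ρ γ T l t : ℝ) : ℝ :=
  (Real.Gamma (1 - ρ))⁻¹ * ∫ x in (0 : ℝ)..t, ((t - x) ^ ρ)⁻¹ * (l * coeffDeriv ρ γ T l x)

section coeff

variable {l₁ T t : ℝ}

theorem relaxation_lt_one (hρ0 : 0 < ρ) (hρ1 : ρ < 1) (hγ : 0 < γ) (hl : 0 < l) (hT : 0 < T) :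
    0 < 1 - relaxation ρ γ l T :=
  (relaxationGap_pos hρ1 hγ hl hT).trans_le (relaxationGap_le hρ0 hρ1 hγ hl hT le_rfl)

theorem coeff_eq_add_integral (hρ0 : 0 < ρ) (hρ1 : ρ < 1) (hγ : 0 < γ) (hl : 0 < l) (hT : 0 < T)
    (ht : 0 ≤ t) : coeff ρ γ T l t =
      coeff ρ γ T l 0 + l * ∫ x in (0 : ℝ)..t, coeffDeriv ρ γ T l x := by
  have h := relaxation_lt_one hρ0 hρ1 hγ hl hT
  have h' : relaxation ρ γ l T - 1 ≠ 0 := by linarith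
  simp only [coeff, coeffDeriv, intervalIntegral.integral_div]
  rw [relaxation_eq_one_sub hρ0 hρ1 hγ hl ht, relaxation_eq_one_sub hρ0 hρ1 hγ hl le_rfl,
    intervalIntegral.integral_same, ← neg_sub (relaxation ρ γ l T) 1, div_neg]
  field_simp
  ring

theorem coeff_terminal (hρ0 : 0 < ρ) (hρ1 : ρ < 1) (hγ : 0 < γ) (hl : 0 < l) (hT : 0 < T) :
    coeff ρ γ T l T = coeff ρ γ T l 0 + 1 := by
  have h := relaxation_lt_one hρ0 hρ1 hγ hl hT
  have h' : relaxation ρ γ l T - 1 ≠ 0 := by linarith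
  have h0 : relaxation ρ γ l 0 = 1 := by simp [relaxation_eq_one_sub hρ0 hρ1 hγ hl le_rfl]
  simp only [coeff, h0]
  field_simp
  ring

theorem abs_coeff_le (hρ0 : 0 < ρ) (hρ1 : ρ < 1) (hγ : 0 < γ) (hl₁ : 0 < l₁) (hT : 0 < T)
    (h : l₁ ≤ l) (ht : 0 ≤ t) : |coeff ρ γ T l t| ≤ (relaxationGap ρ γ l₁ T)⁻¹ := by
  have hl : 0 < l := hl₁.trans_le h
  have hm := relaxationGap_pos hρ1 hγ hl₁ hT
  have hle := relaxationGap_le hρ0 hρ1 hγ hl₁ hT h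
  rw [coeff, abs_div, abs_of_nonneg (relaxation_nonneg hρ0 hρ1 hγ hl t), abs_sub_comm,
    abs_of_pos (hm.trans_le hle), ← one_div]
  exact div_le_div₀ zero_le_one (relaxation_le_one hρ0 hρ1 hγ hl ht) hm hle

theorem abs_coeffDeriv_le (hρ0 : 0 < ρ) (hρ1 : ρ < 1) (hγ : 0 < γ) (hl₁ : 0 < l₁) (hT : 0 < T)
    (h : l₁ ≤ l) : |coeffDeriv ρ γ T l t| ≤ (relaxationGap ρ γ l₁ T)⁻¹ := by
  have hl : 0 < l := hl₁.trans_le h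
  have hm := relaxationGap_pos hρ1 hγ hl₁ hT
  have hle := relaxationGap_le hρ0 hρ1 hγ hl₁ hT h
  rw [coeffDeriv, abs_div, abs_of_nonneg (relaxKernel_nonneg hρ0 hρ1 hγ hl t),
    abs_of_pos (hm.trans_le hle), ← one_div]
  exact div_le_div₀ zero_le_one (relaxKernel_le_one hρ0 hρ1 hγ hl t) hm hle

theorem continuous_coeffDeriv (hρ0 : 0 < ρ) (hρ1 : ρ < 1) (hγ : 0 < γ) (hl : 0 < l) :
    Continuous (coeffDeriv ρ γ T l) :=
  (continuous_relaxKernel hρ0 hρ1 hγ hl).div_const _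

theorem continuousOn_coeff (hρ0 : 0 < ρ) (hρ1 : ρ < 1) (hγ : 0 < γ) (hl : 0 < l) (hT : 0 < T) :
    ContinuousOn (coeff ρ γ T l) (Ici 0) := by
  have hc := intervalIntegral.continuous_primitive (μ := volume) (fun a b =>
    (continuous_coeffDeriv (T := T) hρ0 hρ1 hγ hl).intervalIntegrable a b) 0
  exact ContinuousOn.congr (f := fun t => coeff ρ γ T l 0 +
    l * ∫ x in (0 : ℝ)..t, coeffDeriv ρ γ T l x) (by fun_prop)
    fun t ht => coeff_eq_add_integral hρ0 hρ1 hγ hl hT ht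

theorem coeffCaputo_eq (ρ γ T l t : ℝ) : coeffCaputo ρ γ T l t =
    l / (1 - relaxation ρ γ l T) * ((Real.Gamma (1 - ρ))⁻¹ *
      ∫ x in (0 : ℝ)..t, ((t - x) ^ ρ)⁻¹ * relaxKernel ρ γ l x) := by
  rw [coeffCaputo, ← intervalIntegral.integral_const_mul, ← intervalIntegral.integral_const_mul,
    ← intervalIntegral.integral_const_mul]
  refine intervalIntegral.integral_congr fun x _ => ?_
  simp only [coeffDeriv]
  ring

/-- The scalar relaxation equation. -/
theorem coeff_equation (hρ0 : 0 < ρ) (hρ1 : ρ < 1) (hγ : 0 < γ) (hl : 0 < l) (hT : 0 < T)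
    (ht : 0 < t) :
    coeffDeriv ρ γ T l t + (coeff ρ γ T l t + γ * coeffCaputo ρ γ T l t) = 0 := by
  have h := relaxation_lt_one hρ0 hρ1 hγ hl hT
  have hV := relaxKernel_volterra hρ0 hρ1 hγ hl ht
  have hA := relaxation_eq_one_sub hρ0 hρ1 hγ hl ht.le
  rw [coeffCaputo_eq, coeffDeriv, coeff, ← neg_sub 1 (relaxation ρ γ l T), div_neg]
  generalize (Real.Gamma (1 - ρ))⁻¹ *
    ∫ x in (0 : ℝ)..t, ((t - x) ^ ρ)⁻¹ * relaxKernel ρ γ l x = J at hV ⊢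
  field_simp
  linear_combination hV - hA

/-- The three terms of the Volterra equation are nonnegative with sum 1, so the fractional one, lγJ,
is at most 1. No regularity of the kernel beyond this is used, and the bound does not depend on t.
-/
theorem abs_coeffCaputo_le (hρ0 : 0 < ρ) (hρ1 : ρ < 1) (hγ : 0 < γ) (hl₁ : 0 < l₁) (hT : 0 < T)
    (h : l₁ ≤ l) (ht : 0 < t) :
    |coeffCaputo ρ γ T l t| ≤ γ⁻¹ * (relaxationGap ρ γ l₁ T)⁻¹ := by
  have hl : 0 < l := hl₁.trans_le h
  have hm := relaxationGap_pos hρ1 hγ hl₁ hT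
  have hle := relaxationGap_le hρ0 hρ1 hγ hl₁ hT h
  have hΓ := Real.Gamma_pos_of_pos (show 0 < 1 - ρ by linarith)
  have hV := relaxKernel_volterra hρ0 hρ1 hγ hl ht
  have hp := relaxKernel_nonneg hρ0 hρ1 hγ hl t
  have hi := mul_nonneg hl.le (integral_relaxKernel_nonneg hρ0 hρ1 hγ hl ht.le)
  have hJ : 0 ≤ (Real.Gamma (1 - ρ))⁻¹ *
      ∫ x in (0 : ℝ)..t, ((t - x) ^ ρ)⁻¹ * relaxKernel ρ γ l x := by
    refine mul_nonneg (inv_nonneg.2 hΓ.le) (intervalIntegral.integral_nonneg ht.le fun x hx => ?_)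
    exact mul_nonneg (inv_nonneg.2 (Real.rpow_nonneg (by linarith [hx.2]) _))
      (relaxKernel_nonneg hρ0 hρ1 hγ hl x)
  have hpos := hm.trans_le hle
  rw [coeffCaputo_eq, abs_of_nonneg (mul_nonneg (by positivity) hJ), ← mul_inv]
  generalize (Real.Gamma (1 - ρ))⁻¹ *
    ∫ x in (0 : ℝ)..t, ((t - x) ^ ρ)⁻¹ * relaxKernel ρ γ l x = J at hV hJ ⊢
  rw [div_mul_eq_mul_div, ← one_div]
  rw [div_le_div_iff₀ hpos (by positivity)]
  have h1 : l * γ * J ≤ 1 := by linarith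
  have h2 := mul_le_mul_of_nonneg_right h1 hm.le
  linarith

end coeff

end

/-! ### Extremum principle and maximum principle -/

section

variable {ρ γ l : ℝ}

/-- Slopes from the left are nonnegative at a maximum. Only the left side is available when the
maximum sits at the final time. -/
theorem deriv_nonneg_of_isMaxOn_left {w : ℝ → ℝ} {g t : ℝ} (ht : 0 < t)
    (hw : HasDerivWithinAt w g (Icc 0 t) t) (hmax : ∀ x ∈ Icc 0 t, w x ≤ w t) : 0 ≤ g := by
  have h := hasDerivWithinAt_iff_tendsto_slope.1 (hw.mono Ico_subset_Icc_self)
  rw [sdiff_singleton_eq_self (by simp)] at h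
  have : (𝓝[Ico 0 t] t).NeBot := by
    rw [← mem_closure_iff_nhdsWithin_neBot, closure_Ico ht.ne]
    exact ⟨ht.le, le_rfl⟩
  refine ge_of_tendsto h ?_
  filter_upwards [self_mem_nhdsWithin] with x hx
  rw [slope_def_field]
  exact div_nonneg_of_nonpos (sub_nonpos.2 (hmax x ⟨hx.1, hx.2.le⟩)) (by linarith [hx.2])

/-- **Extremum principle** for the Caputo derivative at a maximum. -/
theorem integral_caputo_nonneg_of_isMaxOn (hρ0 : 0 < ρ) (hρ1 : ρ < 1) {w g : ℝ → ℝ} {t : ℝ}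
    (ht : 0 < t) (hc : ContinuousOn w (Icc 0 t)) (hd : ∀ x ∈ Ioo 0 t, HasDerivAt w (g x) x)
    (hw : HasDerivWithinAt w (g t) (Icc 0 t) t) (hmax : ∀ x ∈ Icc 0 t, w x ≤ w t)
    (hi : IntervalIntegrable (fun x => ((t - x) ^ ρ)⁻¹ * g x) volume 0 t) :
    0 ≤ ∫ x in (0 : ℝ)..t, ((t - x) ^ ρ)⁻¹ * g x := by
  have hne : (𝓝[Ioo 0 t] t).NeBot := by
    rw [← mem_closure_iff_nhdsWithin_neBot, closure_Ioo ht.ne]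
    exact ⟨ht.le, le_rfl⟩
  have hlim : Tendsto (fun s => ∫ x in (0 : ℝ)..s, ((t - x) ^ ρ)⁻¹ * g x) (𝓝[Ioo 0 t] t)
      (𝓝 (∫ x in (0 : ℝ)..t, ((t - x) ^ ρ)⁻¹ * g x)) := by
    have h1 := intervalIntegral.continuousOn_primitive_interval (μ := volume)
      ((intervalIntegrable_iff_integrableOn_Icc_of_le ht.le).1 hi |>.mono_set
        (uIcc_of_le ht.le).subset)
    have h2 := h1 t right_mem_uIcc
    refine h2.tendsto.mono_left (nhdsWithin_mono _ ?_)
    rw [uIcc_of_le ht.le]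
    exact Ioo_subset_Icc_self
  -- The boundary term is -(t - s)^{1-ρ} times the slope of w at t, and the slope converges.
  have hbd : Tendsto (fun s => ((t - s) ^ ρ)⁻¹ * (w s - w t)) (𝓝[Ioo 0 t] t) (𝓝 0) := by
    have h1 := hasDerivWithinAt_iff_tendsto_slope.1 (hw.mono Ioo_subset_Icc_self)
    rw [sdiff_singleton_eq_self (by simp)] at h1
    have h2 : Tendsto (fun s => -(t - s) ^ (1 - ρ)) (𝓝[Ioo 0 t] t) (𝓝 0) := by
      have h3 : ContinuousAt (fun s => -(t - s) ^ (1 - ρ)) t :=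
        (ContinuousAt.rpow_const (by fun_prop) (Or.inr (by linarith))).neg
      have h4 := h3.tendsto
      simp only [sub_self, Real.zero_rpow (show 1 - ρ ≠ 0 by linarith), neg_zero] at h4
      exact h4.mono_left nhdsWithin_le_nhds
    have h5 := h2.mul h1
    rw [zero_mul] at h5
    refine h5.congr' ?_
    filter_upwards [self_mem_nhdsWithin] with s hs
    have hts : 0 < t - s := by linarith [hs.2]
    have hst : s - t ≠ 0 := by linarith
    rw [slope_def_field, sub_eq_add_neg 1 ρ, add_comm, Real.rpow_add_one hts.ne',
      Real.rpow_neg hts.le]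
    field_simp
    ring
  -- Integrate by parts on [0, s], short of the singularity, with w - w(t) as primitive of g. The
  -- boundary term at 0 and the remaining integral both contribute with nonnegative sign because w ≤
  -- w(t), so only the vanishing boundary term at s is left as lower bound.
  refine le_of_tendsto_of_tendsto hbd hlim ?_
  filter_upwards [self_mem_nhdsWithin] with s hs
  have hpos : ∀ x ∈ Icc 0 s, 0 < t - x := fun x hx => by linarith [hx.2, hs.2]
  have hk : ∀ x ∈ Icc 0 s, HasDerivAt (fun x => ((t - x) ^ ρ)⁻¹) (ρ * (t - x) ^ (-ρ - 1)) x := by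
    intro x hx
    have h1 : HasDerivAt (fun x => t - x) (-1) x := by
      simpa using (hasDerivAt_id x).const_sub t
    have h2 := h1.rpow_const (p := -ρ) (Or.inl (hpos x hx).ne')
    have h3 : (fun x => ((t - x) ^ ρ)⁻¹) =ᶠ[𝓝 x] fun x => (t - x) ^ (-ρ) := by
      have : ∀ᶠ u in 𝓝 x, 0 < t - u :=
        (continuous_const.sub continuous_id).continuousAt.eventually (lt_mem_nhds (hpos x hx))
      filter_upwards [this] with u hu
      rw [Real.rpow_neg hu.le]
    refine (h2.congr_of_eventuallyEq h3).congr_deriv ?_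
    ring
  have hkc : ContinuousOn (fun x => ((t - x) ^ ρ)⁻¹) (uIcc 0 s) := by
    rw [uIcc_of_le hs.1.le]
    exact fun x hx => (hk x hx).continuousAt.continuousWithinAt
  have hk'c : ContinuousOn (fun x => ρ * (t - x) ^ (-ρ - 1)) (uIcc 0 s) := by
    rw [uIcc_of_le hs.1.le]
    exact continuousOn_const.mul (ContinuousOn.rpow_const (by fun_prop)
      fun x hx => Or.inl (hpos x hx).ne')
  have his : IntervalIntegrable (fun x => ((t - x) ^ ρ)⁻¹ * g x) volume 0 s :=
    hi.mono_set (by rw [uIcc_of_le hs.1.le, uIcc_of_le ht.le]; exact Icc_subset_Icc_right hs.2.le)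
  -- The derivative may be unbounded near 0; its integrability is recovered from that of the
  -- weighted integrand by multiplying with the continuous function (t - x)^ρ.
  have hg : IntervalIntegrable g volume 0 s := by
    have h1 : ContinuousOn (fun x => (t - x) ^ ρ) (uIcc 0 s) :=
      ContinuousOn.rpow_const (by fun_prop) fun x hx => Or.inr hρ0.le
    refine (his.continuousOn_mul h1).congr fun x hx => ?_
    rw [uIoc_of_le hs.1.le] at hx
    have : (t - x) ^ ρ ≠ 0 := (Real.rpow_pos_of_pos (hpos x ⟨hx.1.le, hx.2⟩) ρ).ne'
    field_simp
  have hwc : ContinuousOn (fun x => w x - w t) (uIcc 0 s) := by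
    rw [uIcc_of_le hs.1.le]
    exact (hc.mono (Icc_subset_Icc_right hs.2.le)).sub continuousOn_const
  have hparts := intervalIntegral.integral_mul_deriv_eq_deriv_mul_of_hasDerivAt
    (u := fun x => ((t - x) ^ ρ)⁻¹) (v := fun x => w x - w t) hkc hwc
    (fun x hx => by
      rw [min_eq_left hs.1.le, max_eq_right hs.1.le] at hx
      exact hk x ⟨hx.1.le, hx.2.le⟩)
    (fun x hx => by
      rw [min_eq_left hs.1.le, max_eq_right hs.1.le] at hx
      exact (hd x ⟨hx.1, hx.2.trans hs.2⟩).sub_const _) hk'c.intervalIntegrable hg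
  rw [hparts]
  have h1 : ∫ x in (0 : ℝ)..s, ρ * (t - x) ^ (-ρ - 1) * (w x - w t) ≤ 0 := by
    have h2 : 0 ≤ ∫ x in (0 : ℝ)..s, -(ρ * (t - x) ^ (-ρ - 1) * (w x - w t)) := by
      refine intervalIntegral.integral_nonneg hs.1.le fun x hx => ?_
      have h3 := hmax x ⟨hx.1, hx.2.trans hs.2.le⟩
      have h4 := Real.rpow_pos_of_pos (hpos x hx) (-ρ - 1)
      rw [← mul_neg]
      exact mul_nonneg (by positivity) (by linarith)
    rw [intervalIntegral.integral_neg] at h2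
    linarith
  have h2 : ((t - 0) ^ ρ)⁻¹ * (w 0 - w t) ≤ 0 :=
    mul_nonpos_of_nonneg_of_nonpos (inv_nonneg.2 (Real.rpow_nonneg (by linarith) _))
      (sub_nonpos.2 (hmax 0 ⟨le_rfl, ht.le⟩))
  linarith

/-- **Maximum principle** for the scalar homogeneous non-local problem. -/
theorem nonpos_of_nonlocal (hρ0 : 0 < ρ) (hρ1 : ρ < 1) (hγ : 0 < γ) (hl : 0 < l) {T : ℝ}
    (hT : 0 < T) {w g : ℝ → ℝ} (hc : ContinuousOn w (Icc 0 T))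
    (hd : ∀ x ∈ Ioc 0 T, HasDerivWithinAt w (g x) (Icc 0 T) x)
    (hi : ∀ t ∈ Ioc 0 T, IntervalIntegrable (fun x => ((t - x) ^ ρ)⁻¹ * g x) volume 0 t)
    (heq : ∀ t ∈ Ioc 0 T, g t + l * (w t + γ * ((Real.Gamma (1 - ρ))⁻¹ *
      ∫ x in (0 : ℝ)..t, ((t - x) ^ ρ)⁻¹ * g x)) = 0)
    (hnl : w T = w 0) {t : ℝ} (ht : t ∈ Icc 0 T) : w t ≤ 0 := by
  obtain ⟨t₁, ht₁, hmax₁⟩ := isCompact_Icc.exists_isMaxOn ⟨t, ht⟩ hc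
  -- The equation says nothing at time 0; a maximum there is moved to T by the non-local condition.
  obtain ⟨t₀, ht₀, hmax⟩ : ∃ t₀ ∈ Ioc 0 T, ∀ x ∈ Icc 0 T, w x ≤ w t₀ := by
    rcases ht₁.1.eq_or_lt with h | h
    · exact ⟨T, ⟨hT, le_rfl⟩, fun x hx => by rw [hnl, h]; exact hmax₁ hx⟩
    · exact ⟨t₁, ⟨h, ht₁.2⟩, fun x hx => hmax₁ hx⟩
  refine (hmax t ht).trans ?_
  by_contra! hpos
  have hsub : Icc 0 t₀ ⊆ Icc 0 T := Icc_subset_Icc_right ht₀.2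
  have hd₀ := (hd t₀ ht₀).mono hsub
  have hm₀ : ∀ x ∈ Icc 0 t₀, w x ≤ w t₀ := fun x hx => hmax x (hsub hx)
  have h1 := deriv_nonneg_of_isMaxOn_left ht₀.1 hd₀ hm₀
  have h2 := integral_caputo_nonneg_of_isMaxOn hρ0 hρ1 ht₀.1 (hc.mono hsub)
    (fun x hx => (hd x ⟨hx.1, hx.2.le.trans ht₀.2⟩).hasDerivAt
      (Icc_mem_nhds hx.1 (hx.2.trans_le ht₀.2))) hd₀ hm₀ (hi t₀ ht₀)
  have h3 := Real.Gamma_pos_of_pos (show 0 < 1 - ρ by linarith)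
  have h4 := heq t₀ ht₀
  have h5 : 0 ≤ γ * ((Real.Gamma (1 - ρ))⁻¹ * ∫ x in (0 : ℝ)..t₀, ((t₀ - x) ^ ρ)⁻¹ * g x) := by
    positivity
  have h6 : 0 < l * (w t₀ + γ * ((Real.Gamma (1 - ρ))⁻¹ *
      ∫ x in (0 : ℝ)..t₀, ((t₀ - x) ^ ρ)⁻¹ * g x)) := mul_pos hl (by linarith)
  linarith

end

/-! ### Diagonal operators and the self-adjoint operator in its eigenbasis -/

section

section Diagonal

variable {𝕜 : Type*} [RCLike 𝕜] {H : Type*} [NormedAddCommGroup H] [InnerProductSpace 𝕜 H]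

/-- Any real normed space structure on a normed space over `𝕜` is the restriction of scalars. -/
theorem isScalarTower_real [NormedSpace ℝ H] : IsScalarTower ℝ 𝕜 H where
  smul_assoc r c x := by
    -- A continuous additive map between real topological vector spaces is real-linear, whichever
    -- real structure `H` carries.
    have hc : Continuous (AddMonoidHom.mk' (fun c : 𝕜 => c • x) fun a b => add_smul a b x) :=
      (continuous_id.smul continuous_const : Continuous fun c : 𝕜 => c • x)
    exact map_real_smul (AddMonoidHom.mk' (fun c : 𝕜 => c • x) fun a b => add_smul a b x) hc r c

theorem summable_norm_inner_sq (v : HilbertBasis ℕ 𝕜 H) (x : H) :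
    Summable fun k => ‖inner 𝕜 (v k) x‖ ^ 2 := by
  have h := (lp.memℓp (v.repr x)).summable (by norm_num)
  simpa [HilbertBasis.repr_apply_apply] using h

theorem norm_sq_eq_tsum (v : HilbertBasis ℕ 𝕜 H) (x : H) :
    ‖x‖ ^ 2 = ∑' k, ‖inner 𝕜 (v k) x‖ ^ 2 := by
  have h := lp.norm_rpow_eq_tsum (p := 2) (by norm_num) (v.repr x)
  simpa [HilbertBasis.repr_apply_apply] using h

theorem ext_inner_basis (v : HilbertBasis ℕ 𝕜 H) {x y : H}
    (h : ∀ k, inner 𝕜 (v k) x = inner 𝕜 (v k) y) : x = y := by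
  apply v.repr.injective
  ext k
  simpa [HilbertBasis.repr_apply_apply] using h k

/-- The diagonal operator `x ↦ ∑ f(k) (v_k, x) v_k`. -/
def diag (v : HilbertBasis ℕ 𝕜 H) (f : ℕ → ℝ) (x : H) : H :=
  ∑' k, ((f k : 𝕜) * inner 𝕜 (v k) x) • v k

variable (v : HilbertBasis ℕ 𝕜 H) {f : ℕ → ℝ} {B : ℝ}

theorem memℓp_diag (hf : ∀ k, |f k| ≤ B) (x : H) :
    Memℓp (fun k => (f k : 𝕜) * inner 𝕜 (v k) x) 2 := by
  refine memℓp_gen ?_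
  have hs := (summable_norm_inner_sq v x).mul_left (B ^ 2)
  refine Summable.of_nonneg_of_le (fun k => by positivity) (fun k => ?_) hs
  have h2 : (2 : ENNReal).toReal = (2 : ℕ) := by norm_num
  rw [h2, Real.rpow_natCast, norm_mul, mul_pow, RCLike.norm_ofReal]
  have h3 : |f k| ^ 2 ≤ B ^ 2 := pow_le_pow_left₀ (abs_nonneg _) (hf k) 2
  exact mul_le_mul_of_nonneg_right h3 (by positivity)

theorem hasSum_diag [CompleteSpace H] (hf : ∀ k, |f k| ≤ B) (x : H) :
    HasSum (fun k => ((f k : 𝕜) * inner 𝕜 (v k) x) • v k) (diag v f x) :=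
  (v.hasSum_repr_symm ⟨_, memℓp_diag v hf x⟩).summable.hasSum

theorem inner_diag [CompleteSpace H] (hf : ∀ k, |f k| ≤ B) (x : H) (k : ℕ) :
    inner 𝕜 (v k) (diag v f x) = (f k : 𝕜) * inner 𝕜 (v k) x := by
  have h := v.hasSum_repr_symm ⟨_, memℓp_diag v hf x⟩
  have h1 : diag v f x = v.repr.symm ⟨_, memℓp_diag v hf x⟩ := h.tsum_eq
  rw [h1, ← HilbertBasis.repr_apply_apply, LinearIsometryEquiv.apply_symm_apply]

theorem norm_diag_le [CompleteSpace H] (hf : ∀ k, |f k| ≤ B) (x : H) :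
    ‖diag v f x‖ ^ 2 ≤ B ^ 2 * ‖x‖ ^ 2 := by
  rw [norm_sq_eq_tsum v, norm_sq_eq_tsum v x, ← tsum_mul_left]
  refine Summable.tsum_le_tsum (fun k => ?_) (summable_norm_inner_sq v _)
    ((summable_norm_inner_sq v x).mul_left _)
  rw [inner_diag v hf, norm_mul, mul_pow, RCLike.norm_ofReal]
  have h3 : |f k| ^ 2 ≤ B ^ 2 := pow_le_pow_left₀ (abs_nonneg _) (hf k) 2
  exact mul_le_mul_of_nonneg_right h3 (by positivity)

/-- By Parseval the squared distance is a series whose terms tend to 0 one by one and are dominated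
by (2B)² |(v_k, x)|²; dominated convergence concludes. -/
theorem continuousOn_diag [CompleteSpace H] {F : ℝ → ℕ → ℝ} {s : Set ℝ}
    (hF : ∀ t ∈ s, ∀ k, |F t k| ≤ B) (hc : ∀ k, ContinuousOn (fun t => F t k) s) (x : H) :
    ContinuousOn (fun t => diag v (F t) x) s := by
  intro t₀ ht₀
  rw [ContinuousWithinAt, tendsto_iff_norm_sub_tendsto_zero]
  have hsq : Tendsto (fun t => ‖diag v (F t) x - diag v (F t₀) x‖ ^ 2) (𝓝[s] t₀) (𝓝 0) := by
    have hnorm : ∀ t ∈ s, ‖diag v (F t) x - diag v (F t₀) x‖ ^ 2 =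
        ∑' k, (F t k - F t₀ k) ^ 2 * ‖inner 𝕜 (v k) x‖ ^ 2 := by
      intro t ht
      rw [norm_sq_eq_tsum v]
      congr 1 with k
      rw [inner_sub_right, inner_diag v (hF t ht), inner_diag v (hF t₀ ht₀), ← sub_mul,
        ← RCLike.ofReal_sub, norm_mul, mul_pow, RCLike.norm_ofReal, sq_abs]
    have h0 : (0 : ℝ) = ∑' k, (0 : ℝ) * ‖inner 𝕜 (v k) x‖ ^ 2 := by simp
    rw [h0]
    refine Tendsto.congr' (f₁ := fun t => ∑' k, (F t k - F t₀ k) ^ 2 * ‖inner 𝕜 (v k) x‖ ^ 2)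
      ?_ ?_
    · filter_upwards [self_mem_nhdsWithin] with t ht
      exact (hnorm t ht).symm
    · refine tendsto_tsum_of_dominated_convergence
        (bound := fun k => (2 * B) ^ 2 * ‖inner 𝕜 (v k) x‖ ^ 2)
        ((summable_norm_inner_sq v x).mul_left _) (fun k => ?_) ?_
      · have h1 : Tendsto (fun t => F t k - F t₀ k) (𝓝[s] t₀) (𝓝 0) := by
          simpa using (hc k t₀ ht₀).tendsto.sub_const (F t₀ k)
        simpa using (h1.pow 2).mul_const (‖inner 𝕜 (v k) x‖ ^ 2)
      · filter_upwards [self_mem_nhdsWithin] with t ht k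
        rw [norm_mul, norm_pow, norm_pow, norm_norm, Real.norm_eq_abs]
        refine mul_le_mul_of_nonneg_right (pow_le_pow_left₀ (abs_nonneg _) ?_ 2) (by positivity)
        have h1 := abs_sub (F t k) (F t₀ k)
        linarith [hF t ht k, hF t₀ ht₀ k]
  have h2 := hsq.sqrt
  simpa using h2

end Diagonal

section Operator

variable {𝕜 : Type*} [RCLike 𝕜] {H : Type*} [NormedAddCommGroup H] [InnerProductSpace 𝕜 H]
  {A : H →ₗ.[𝕜] H} {v : HilbertBasis ℕ 𝕜 H} {lam : ℕ → ℝ}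

theorem opVal_of_mem {x : H} (hx : x ∈ A.domain) : opVal A x = A ⟨x, hx⟩ := dif_pos hx

theorem opVal_add_smul {x y : H} (hx : x ∈ A.domain) (hy : y ∈ A.domain) (c : 𝕜) :
    opVal A (x + c • y) = opVal A x + c • opVal A y := by
  rw [opVal_of_mem hx, opVal_of_mem hy,
    opVal_of_mem (A.domain.add_mem hx (A.domain.smul_mem c hy)), ← A.map_smul, ← A.map_add]
  rfl

variable [CompleteSpace H]

theorem IsDiagonalized.inner_opVal (h : IsDiagonalized A v lam) {x : H} (hx : x ∈ A.domain)
    (k : ℕ) : inner 𝕜 (v k) (opVal A x) = (lam k : 𝕜) * inner 𝕜 (v k) x := by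
  have hf := A.adjoint_isFormalAdjoint h.selfAdjoint.dense_domain
  rw [LinearPMap.isSelfAdjoint_def.1 h.selfAdjoint] at hf
  have h1 := hf ⟨v k, h.mem_domain k⟩ ⟨x, hx⟩
  have h2 := h.eigen k
  rw [opVal_of_mem (h.mem_domain k)] at h2
  rw [opVal_of_mem hx]
  rw [h2, inner_smul_left, RCLike.conj_ofReal] at h1
  exact h1.symm

/-- By Parseval, y represents the functional z ↦ (x, Az) on D(A), so x lies in the domain of the
adjoint. Here symmetry would not be enough: the equality of A with its adjoint puts x in D(A). -/
theorem IsDiagonalized.mem_domain_of_inner (h : IsDiagonalized A v lam) {x y : H}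
    (hxy : ∀ k, inner 𝕜 (v k) y = (lam k : 𝕜) * inner 𝕜 (v k) x) :
    x ∈ A.domain ∧ opVal A x = y := by
  have hd := h.selfAdjoint.dense_domain
  have hx : x ∈ A.domain := by
    rw [← LinearPMap.isSelfAdjoint_def.1 h.selfAdjoint]
    refine LinearPMap.mem_adjoint_domain_of_exists x ⟨y, fun z => ?_⟩
    rw [← v.tsum_inner_mul_inner, ← v.tsum_inner_mul_inner x]
    congr 1 with k
    have h1 := h.inner_opVal z.2 k
    rw [opVal_of_mem z.2] at h1
    rw [h1, ← inner_conj_symm y, hxy, ← inner_conj_symm x]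
    simp
    ring
  exact ⟨hx, ext_inner_basis v fun k => by rw [h.inner_opVal hx, hxy]⟩

theorem IsDiagonalized.opVal_diag (h : IsDiagonalized A v lam) {f : ℕ → ℝ} {B : ℝ}
    (hf : ∀ k, |f k| ≤ B) {x : H} (hx : x ∈ A.domain) :
    diag v f x ∈ A.domain ∧ opVal A (diag v f x) = diag v f (opVal A x) :=
  h.mem_domain_of_inner fun k => by
    rw [inner_diag v hf, inner_diag v hf, h.inner_opVal hx]
    ring

end Operator

end

/-! ### Construction of the solution in H and its estimate -/

section

variable {𝕜 : Type*} [RCLike 𝕜] {H : Type*} [NormedAddCommGroup H] [InnerProductSpace 𝕜 H]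

/-- The derivative of the solution with data `ψ`, where `y = A ψ`. -/
def velocity (v : HilbertBasis ℕ 𝕜 H) (ρ γ T : ℝ) (lam : ℕ → ℝ) (y : H) (t : ℝ) : H :=
  diag v (fun k => coeffDeriv ρ γ T (lam k) t) y

theorem continuous_velocity [CompleteSpace H] (v : HilbertBasis ℕ 𝕜 H) {ρ γ T lam₁ : ℝ}
    {lam : ℕ → ℝ} (hρ0 : 0 < ρ) (hρ1 : ρ < 1) (hγ : 0 < γ) (hl₁ : 0 < lam₁)
    (hT : 0 < T) (hlam : ∀ k, lam₁ ≤ lam k) (y : H) : Continuous (velocity v ρ γ T lam y) := by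
  rw [← continuousOn_univ]
  exact continuousOn_diag v (fun t _ k => abs_coeffDeriv_le hρ0 hρ1 hγ hl₁ hT (hlam k))
    (fun k => (continuous_coeffDeriv hρ0 hρ1 hγ (hl₁.trans_le (hlam k))).continuousOn) y

theorem intervalIntegral_coe (f : ℝ → ℝ) (a b : ℝ) :
    ∫ x in a..b, (f x : 𝕜) = ((∫ x in a..b, f x : ℝ) : 𝕜) := by
  simp only [intervalIntegral, integral_ofReal, RCLike.ofReal_sub]

variable [NormedSpace ℝ H]

theorem real_smul_eq_coe_smul (r : ℝ) (x : H) : r • x = (r : 𝕜) • x :=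
  haveI : IsScalarTower ℝ 𝕜 H := isScalarTower_real
  RCLike.real_smul_eq_coe_smul r x

/-- The functional `(e, ·)`, as a real-linear map. -/
def innerReal (𝕜 : Type*) [RCLike 𝕜] {H : Type*} [NormedAddCommGroup H] [InnerProductSpace 𝕜 H]
    [NormedSpace ℝ H] (e : H) : H →L[ℝ] 𝕜 :=
  haveI : IsScalarTower ℝ 𝕜 H := isScalarTower_real
  (innerSL 𝕜 e).restrictScalars ℝ

theorem innerReal_apply (e x : H) : innerReal 𝕜 e x = inner 𝕜 e x := rfl

theorem intervalIntegrable_caputoWeight_smul {ρ : ℝ} (hρ1 : ρ < 1) {t : ℝ} (ht : 0 ≤ t)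
    {V : ℝ → H} (hV : Continuous V) :
    IntervalIntegrable (fun x => ((t - x) ^ ρ)⁻¹ • V x) volume 0 t :=
  (intervalIntegrable_caputoWeight hρ1 ht).smul_continuousOn hV.continuousOn

section Solution

variable [CompleteSpace H]

/-- The solution of the non-local problem with data `ψ`, where `y = A ψ`. -/
def solution (v : HilbertBasis ℕ 𝕜 H) (ρ γ T : ℝ) (lam : ℕ → ℝ) (ψ y : H) (t : ℝ) : H :=
  diag v (fun k => coeff ρ γ T (lam k) 0) ψ + ∫ s in (0 : ℝ)..t, velocity v ρ γ T lam y s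

variable {ρ γ T lam₁ : ℝ} {lam : ℕ → ℝ} (v : HilbertBasis ℕ 𝕜 H) {ψ y : H} {t : ℝ}

/-- Since `solution` is a primitive of a continuous velocity, the fundamental theorem of calculus
replaces termwise differentiation of the series; `solution_eq_diag` recovers the series afterwards.
-/
theorem hasDerivAt_solution (hρ0 : 0 < ρ) (hρ1 : ρ < 1) (hγ : 0 < γ) (hl₁ : 0 < lam₁)
    (hT : 0 < T) (hlam : ∀ k, lam₁ ≤ lam k) (ψ y : H) (t : ℝ) :
    HasDerivAt (solution v ρ γ T lam ψ y) (velocity v ρ γ T lam y t) t := by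
  have hc := continuous_velocity v hρ0 hρ1 hγ hl₁ hT hlam y
  exact (intervalIntegral.integral_hasDerivAt_right (hc.intervalIntegrable _ _)
    (hc.stronglyMeasurableAtFilter _ _) hc.continuousAt).const_add _

/-- Reduces vector integrals to their scalar coordinates. It is used with weight 1 for the solution
itself and with the Caputo weight for its fractional derivative. -/
theorem inner_integral_smul_velocity (hρ0 : 0 < ρ) (hρ1 : ρ < 1) (hγ : 0 < γ) (hl₁ : 0 < lam₁)
    (hT : 0 < T) (hlam : ∀ k, lam₁ ≤ lam k)
    (hy : ∀ k, inner 𝕜 (v k) y = (lam k : 𝕜) * inner 𝕜 (v k) ψ) {w : ℝ → ℝ}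
    (hw : IntervalIntegrable (fun s => w s • velocity v ρ γ T lam y s) volume 0 t) (k : ℕ) :
    inner 𝕜 (v k) (∫ s in (0 : ℝ)..t, w s • velocity v ρ γ T lam y s) =
      ((∫ s in (0 : ℝ)..t, w s * (lam k * coeffDeriv ρ γ T (lam k) s) : ℝ) : 𝕜) *
        inner 𝕜 (v k) ψ := by
  rw [← innerReal_apply, ← ContinuousLinearMap.intervalIntegral_comp_comm _ hw,
    ← intervalIntegral_coe, ← intervalIntegral.integral_mul_const]
  refine intervalIntegral.integral_congr fun s _ => ?_
  simp only [map_smul]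
  rw [innerReal_apply, velocity,
    inner_diag v (fun k => abs_coeffDeriv_le hρ0 hρ1 hγ hl₁ hT (hlam k)), hy,
    RCLike.real_smul_eq_coe_mul]
  push_cast
  ring

theorem solution_eq_diag (hρ0 : 0 < ρ) (hρ1 : ρ < 1) (hγ : 0 < γ) (hl₁ : 0 < lam₁)
    (hT : 0 < T) (hlam : ∀ k, lam₁ ≤ lam k)
    (hy : ∀ k, inner 𝕜 (v k) y = (lam k : 𝕜) * inner 𝕜 (v k) ψ) (ht : 0 ≤ t) :
    solution v ρ γ T lam ψ y t = diag v (fun k => coeff ρ γ T (lam k) t) ψ := by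
  have hc := continuous_velocity v hρ0 hρ1 hγ hl₁ hT hlam y
  refine ext_inner_basis v fun k => ?_
  have h := inner_integral_smul_velocity (t := t) v hρ0 hρ1 hγ hl₁ hT hlam hy (w := fun _ => 1)
    (by simpa using hc.intervalIntegrable 0 t) k
  simp only [one_smul, one_mul, intervalIntegral.integral_const_mul] at h
  rw [solution, inner_add_right, h,
    inner_diag v (fun k => abs_coeff_le hρ0 hρ1 hγ hl₁ hT (hlam k) le_rfl),
    inner_diag v (fun k => abs_coeff_le hρ0 hρ1 hγ hl₁ hT (hlam k) ht), ← add_mul,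
    coeff_eq_add_integral hρ0 hρ1 hγ (hl₁.trans_le (hlam k)) hT ht]
  push_cast
  rfl

theorem caputoIntegrand_solution (hρ0 : 0 < ρ) (hρ1 : ρ < 1) (hγ : 0 < γ) (hl₁ : 0 < lam₁)
    (hT : 0 < T) (hlam : ∀ k, lam₁ ≤ lam k) (ψ y : H) (t : ℝ) :
    caputoIntegrand ρ (solution v ρ γ T lam ψ y) t =
      fun s => ((t - s) ^ ρ)⁻¹ • velocity v ρ γ T lam y s := by
  ext s
  rw [caputoIntegrand, (hasDerivAt_solution v hρ0 hρ1 hγ hl₁ hT hlam ψ y s).deriv]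

theorem caputo_solution (hρ0 : 0 < ρ) (hρ1 : ρ < 1) (hγ : 0 < γ) (hl₁ : 0 < lam₁)
    (hT : 0 < T) (hlam : ∀ k, lam₁ ≤ lam k)
    (hy : ∀ k, inner 𝕜 (v k) y = (lam k : 𝕜) * inner 𝕜 (v k) ψ) (ht : 0 < t) :
    caputo ρ (solution v ρ γ T lam ψ y) t = diag v (fun k => coeffCaputo ρ γ T (lam k) t) ψ := by
  have hc := continuous_velocity v hρ0 hρ1 hγ hl₁ hT hlam y
  refine ext_inner_basis v fun k => ?_
  rw [caputo, caputoIntegrand_solution v hρ0 hρ1 hγ hl₁ hT hlam, real_smul_eq_coe_smul (𝕜 := 𝕜),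
    inner_smul_right, inner_integral_smul_velocity v hρ0 hρ1 hγ hl₁ hT hlam hy
      (intervalIntegrable_caputoWeight_smul hρ1 ht.le hc),
    inner_diag v (fun k => abs_coeffCaputo_le hρ0 hρ1 hγ hl₁ hT (hlam k) ht), coeffCaputo]
  push_cast
  ring

theorem derivWithin_solution (hρ0 : 0 < ρ) (hρ1 : ρ < 1) (hγ : 0 < γ) (hl₁ : 0 < lam₁)
    (hT : 0 < T) (hlam : ∀ k, lam₁ ≤ lam k) (ψ y : H) (ht : t ∈ Icc 0 T) :
    derivWithin (solution v ρ γ T lam ψ y) (Icc 0 T) t = velocity v ρ γ T lam y t :=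
  (hasDerivAt_solution v hρ0 hρ1 hγ hl₁ hT hlam ψ y t).hasDerivWithinAt.derivWithin
    (uniqueDiffOn_Icc hT t ht)

theorem IsDiagonalized.isNonlocalSolution {A : H →ₗ.[𝕜] H} {v : HilbertBasis ℕ 𝕜 H}
    (h : IsDiagonalized A v lam) (hρ0 : 0 < ρ) (hρ1 : ρ < 1) (hγ : 0 < γ) (hl₁ : 0 < lam₁)
    (hT : 0 < T) (hlam : ∀ k, lam₁ ≤ lam k) (hψ : ψ ∈ A.domain) :
    IsNonlocalSolution A ρ γ T ψ (solution v ρ γ T lam ψ (opVal A ψ)) := by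
  have hy := h.inner_opVal hψ
  have hl : ∀ k, 0 < lam k := fun k => hl₁.trans_le (hlam k)
  have hd := hasDerivAt_solution v hρ0 hρ1 hγ hl₁ hT hlam ψ (opVal A ψ)
  have hc := continuous_velocity v hρ0 hρ1 hγ hl₁ hT hlam (opVal A ψ)
  have hdw : ∀ t ∈ Ioc 0 T, derivWithin (solution v ρ γ T lam ψ (opVal A ψ)) (Icc 0 T) t =
      velocity v ρ γ T lam (opVal A ψ) t := fun t ht =>
    derivWithin_solution v hρ0 hρ1 hγ hl₁ hT hlam ψ _ (Ioc_subset_Icc_self ht)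
  have hW : ∀ t ∈ Ioc 0 T, solution v ρ γ T lam ψ (opVal A ψ) t ∈ A.domain ∧
      opVal A (solution v ρ γ T lam ψ (opVal A ψ) t) =
        diag v (fun k => coeff ρ γ T (lam k) t) (opVal A ψ) := fun t ht => by
    rw [solution_eq_diag v hρ0 hρ1 hγ hl₁ hT hlam hy ht.1.le]
    exact h.opVal_diag (fun k => abs_coeff_le hρ0 hρ1 hγ hl₁ hT (hlam k) ht.1.le) hψ
  have hC : ∀ t ∈ Ioc 0 T, caputo ρ (solution v ρ γ T lam ψ (opVal A ψ)) t ∈ A.domain ∧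
      opVal A (caputo ρ (solution v ρ γ T lam ψ (opVal A ψ)) t) =
        diag v (fun k => coeffCaputo ρ γ T (lam k) t) (opVal A ψ) := fun t ht => by
    rw [caputo_solution v hρ0 hρ1 hγ hl₁ hT hlam hy ht.1]
    exact h.opVal_diag (fun k => abs_coeffCaputo_le hρ0 hρ1 hγ hl₁ hT (hlam k) ht.1) hψ
  have hWc : ContinuousOn (fun t => opVal A (solution v ρ γ T lam ψ (opVal A ψ) t)) (Ioc 0 T) :=
    (continuousOn_diag v (fun t ht k => abs_coeff_le hρ0 hρ1 hγ hl₁ hT (hlam k) ht.1.le)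
      (fun k => (continuousOn_coeff hρ0 hρ1 hγ (hl k) hT).mono fun t ht => ht.1.le)
      (opVal A ψ)).congr fun t ht => (hW t ht).2
  have heq : ∀ t ∈ Ioc 0 T, velocity v ρ γ T lam (opVal A ψ) t +
      (opVal A (solution v ρ γ T lam ψ (opVal A ψ) t) +
        (γ : 𝕜) • opVal A (caputo ρ (solution v ρ γ T lam ψ (opVal A ψ)) t)) = 0 := by
    intro t ht
    refine ext_inner_basis v fun k => ?_
    rw [(hW t ht).2, (hC t ht).2, velocity, inner_add_right, inner_add_right, inner_smul_right,
      inner_diag v (fun k => abs_coeffDeriv_le hρ0 hρ1 hγ hl₁ hT (hlam k)),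
      inner_diag v (fun k => abs_coeff_le hρ0 hρ1 hγ hl₁ hT (hlam k) ht.1.le),
      inner_diag v (fun k => abs_coeffCaputo_le hρ0 hρ1 hγ hl₁ hT (hlam k) ht.1), inner_zero_right]
    have h1 := congrArg (fun r : ℝ => (r : 𝕜)) (coeff_equation hρ0 hρ1 hγ (hl k) hT ht.1)
    push_cast at h1
    linear_combination (inner 𝕜 (v k) (opVal A ψ)) * h1
  refine ⟨fun t _ => (hd t).continuousAt.continuousWithinAt,
    fun t _ => (hd t).differentiableAt.differentiableWithinAt,
    hc.continuousOn.congr hdw, fun t ht => (hW t ht).1, hWc, fun t ht => ?_,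
    fun t ht => (hC t ht).1, ?_, fun t ht => ?_, ?_⟩
  · rw [CaputoExists, caputoIntegrand_solution v hρ0 hρ1 hγ hl₁ hT hlam]
    exact intervalIntegrable_caputoWeight_smul hρ1 ht.1.le hc
  -- Continuity of A D_t^ρ W is read off from the equation, solved for this term using γ ≠ 0.
  · have h1 : ContinuousOn (fun t => -((γ : 𝕜)⁻¹ • (velocity v ρ γ T lam (opVal A ψ) t +
        opVal A (solution v ρ γ T lam ψ (opVal A ψ) t)))) (Ioc 0 T) :=
      ((hc.continuousOn.add hWc).const_smul _).neg
    refine h1.congr fun t ht => ?_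
    have hγ' : (γ : 𝕜) ≠ 0 := RCLike.ofReal_ne_zero.2 hγ.ne'
    beta_reduce
    rw [← smul_neg, eq_inv_smul_iff₀ hγ', eq_neg_iff_add_eq_zero, ← heq t ht]
    abel
  · rw [hdw t ht, real_smul_eq_coe_smul (𝕜 := 𝕜), opVal_add_smul (hW t ht).1 (hC t ht).1]
    exact heq t ht
  · refine ext_inner_basis v fun k => ?_
    rw [solution_eq_diag v hρ0 hρ1 hγ hl₁ hT hlam hy hT.le,
      solution_eq_diag v hρ0 hρ1 hγ hl₁ hT hlam hy le_rfl, inner_add_right,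
      inner_diag v (fun k => abs_coeff_le hρ0 hρ1 hγ hl₁ hT (hlam k) hT.le),
      inner_diag v (fun k => abs_coeff_le hρ0 hρ1 hγ hl₁ hT (hlam k) le_rfl),
      coeff_terminal hρ0 hρ1 hγ (hl k) hT]
    push_cast
    ring

/-- Each of the three vectors is a diagonal operator applied to Aψ, with symbol bounded by m⁻¹, m⁻¹
and γ⁻¹m⁻¹, where m is `relaxationGap`; the squares add up to the constant. -/
theorem IsDiagonalized.solution_bound {A : H →ₗ.[𝕜] H} {v : HilbertBasis ℕ 𝕜 H}
    (h : IsDiagonalized A v lam) (hρ0 : 0 < ρ) (hρ1 : ρ < 1) (hγ : 0 < γ) (hl₁ : 0 < lam₁)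
    (hT : 0 < T) (hlam : ∀ k, lam₁ ≤ lam k) (hψ : ψ ∈ A.domain) (ht : t ∈ Ioc 0 T) :
    ‖derivWithin (solution v ρ γ T lam ψ (opVal A ψ)) (Icc 0 T) t‖ ^ 2 +
        ‖opVal A (solution v ρ γ T lam ψ (opVal A ψ) t)‖ ^ 2 +
        ‖opVal A (caputo ρ (solution v ρ γ T lam ψ (opVal A ψ)) t)‖ ^ 2 ≤
      (relaxationGap ρ γ lam₁ T)⁻¹ ^ 2 * (2 + γ⁻¹ ^ 2) * ‖opVal A ψ‖ ^ 2 := by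
  have hy := h.inner_opVal hψ
  have b1 := fun k => abs_coeffDeriv_le (t := t) hρ0 hρ1 hγ hl₁ hT (hlam k)
  have b2 := fun k => abs_coeff_le hρ0 hρ1 hγ hl₁ hT (hlam k) ht.1.le
  have b3 := fun k => abs_coeffCaputo_le hρ0 hρ1 hγ hl₁ hT (hlam k) ht.1
  rw [derivWithin_solution v hρ0 hρ1 hγ hl₁ hT hlam ψ _ (Ioc_subset_Icc_self ht),
    solution_eq_diag v hρ0 hρ1 hγ hl₁ hT hlam hy ht.1.le,
    caputo_solution v hρ0 hρ1 hγ hl₁ hT hlam hy ht.1, (h.opVal_diag b2 hψ).2,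
    (h.opVal_diag b3 hψ).2, velocity]
  have n1 := norm_diag_le v b1 (opVal A ψ)
  have n2 := norm_diag_le v b2 (opVal A ψ)
  have n3 := norm_diag_le v b3 (opVal A ψ)
  rw [mul_pow] at n3
  linarith

end Solution

/-! ### Uniqueness by testing against eigenvectors -/

section Uniqueness

variable [CompleteSpace H] {ρ γ T : ℝ} {ψ : H} {A : H →ₗ.[𝕜] H} {U : ℝ → H}

theorem IsNonlocalSolution.caputo_functional (hU : IsNonlocalSolution A ρ γ T ψ U)
    (hρ0 : 0 < ρ) (φ : H →L[ℝ] ℝ) {t : ℝ} (ht : t ∈ Ioc 0 T) :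
    IntervalIntegrable (fun x => ((t - x) ^ ρ)⁻¹ * φ (derivWithin U (Icc 0 T) x)) volume 0 t ∧
      φ (caputo ρ U t) = (Real.Gamma (1 - ρ))⁻¹ *
        ∫ x in (0 : ℝ)..t, ((t - x) ^ ρ)⁻¹ * φ (derivWithin U (Icc 0 T) x) := by
  have h1 : IntervalIntegrable (caputoIntegrand ρ U t) volume 0 t := hU.caputoExists t ht
  have heq : ∀ x ∈ Ioc 0 t, φ (caputoIntegrand ρ U t x) =
      ((t - x) ^ ρ)⁻¹ * φ (derivWithin U (Icc 0 T) x) := fun x hx => by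
    rw [caputoIntegrand, map_smul, smul_eq_mul]
    rcases hx.2.eq_or_lt with h | h
    -- At x = t the weight is `0⁻¹ = 0`, so the two-sided `deriv`, which is uncontrolled when t = T,
    -- plays no role.
    · simp [h, Real.zero_rpow hρ0.ne']
    · rw [derivWithin_of_mem_nhds (Icc_mem_nhds hx.1 (h.trans_le ht.2))]
  have h2 : IntervalIntegrable (fun x => φ (caputoIntegrand ρ U t x)) volume 0 t :=
    ⟨φ.integrable_comp h1.1, φ.integrable_comp h1.2⟩
  refine ⟨h2.congr fun x hx => ?_, ?_⟩
  · rw [uIoc_of_le ht.1.le] at hx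
    exact heq x hx
  · rw [caputo, map_smul, smul_eq_mul, ← φ.intervalIntegral_comp_comm h1,
      intervalIntegral.integral_of_le ht.1.le, intervalIntegral.integral_of_le ht.1.le,
      setIntegral_congr_fun measurableSet_Ioc heq]

/-- The datum ψ cancels in the difference of two solutions, and a real functional that is an
eigenvector for A turns the difference into a scalar solution with equal end values, to which
`nonpos_of_nonlocal` applies. -/
theorem IsNonlocalSolution.functional_le {W : ℝ → H} (hU : IsNonlocalSolution A ρ γ T ψ U)
    (hW : IsNonlocalSolution A ρ γ T ψ W) (hρ0 : 0 < ρ) (hρ1 : ρ < 1) (hγ : 0 < γ)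
    (hT : 0 < T) (φ : H →L[ℝ] ℝ) {l : ℝ} (hl : 0 < l)
    (hφ : ∀ x ∈ A.domain, φ (opVal A x) = l * φ x) {t : ℝ} (ht : t ∈ Icc 0 T) :
    φ (U t) ≤ φ (W t) := by
  have hdom : ∀ {Z : ℝ → H}, IsNonlocalSolution A ρ γ T ψ Z → ∀ s ∈ Ioc 0 T,
      φ (derivWithin Z (Icc 0 T) s) + l * (φ (Z s) + γ * φ (caputo ρ Z s)) = 0 := by
    intro Z hZ s hs
    have h1 := congrArg φ (hZ.equation s hs)
    have h2 : Z s + γ • caputo ρ Z s ∈ A.domain := by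
      rw [real_smul_eq_coe_smul (𝕜 := 𝕜)]
      exact A.domain.add_mem (hZ.mem_domain s hs) (A.domain.smul_mem _ (hZ.caputo_mem_domain s hs))
    rwa [map_add, hφ _ h2, map_add, map_smul, smul_eq_mul, map_zero] at h1
  have hderiv : ∀ {Z : ℝ → H}, IsNonlocalSolution A ρ γ T ψ Z → ∀ s ∈ Ioc 0 T,
      HasDerivWithinAt (fun s => φ (Z s)) (φ (derivWithin Z (Icc 0 T) s)) (Icc 0 T) s :=
    fun hZ s hs => φ.hasFDerivAt.comp_hasDerivWithinAt s (hZ.differentiable s hs).hasDerivWithinAt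
  have hnl : ∀ {Z : ℝ → H}, IsNonlocalSolution A ρ γ T ψ Z → φ (Z T) = φ (Z 0) + φ ψ :=
    fun hZ => by rw [hZ.nonlocal, map_add]
  have hint : ∀ s ∈ Ioc 0 T, (fun x => ((s - x) ^ ρ)⁻¹ *
      (φ (derivWithin U (Icc 0 T) x) - φ (derivWithin W (Icc 0 T) x))) = fun x =>
      ((s - x) ^ ρ)⁻¹ * φ (derivWithin U (Icc 0 T) x) -
        ((s - x) ^ ρ)⁻¹ * φ (derivWithin W (Icc 0 T) x) := fun s _ => by
    ext x
    ring
  refine sub_nonpos.1 (nonpos_of_nonlocal hρ0 hρ1 hγ hl hT (w := fun s => φ (U s) - φ (W s))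
    (g := fun s => φ (derivWithin U (Icc 0 T) s) - φ (derivWithin W (Icc 0 T) s))
    ((φ.continuous.comp_continuousOn hU.continuousOn).sub
      (φ.continuous.comp_continuousOn hW.continuousOn))
    (fun s hs => (hderiv hU s hs).sub (hderiv hW s hs)) (fun s hs => ?_) (fun s hs => ?_) ?_ ht)
  · rw [hint s hs]
    exact (hU.caputo_functional hρ0 φ hs).1.sub (hW.caputo_functional hρ0 φ hs).1
  · have hu := hU.caputo_functional hρ0 φ hs
    have hw := hW.caputo_functional hρ0 φ hs
    rw [hint s hs, intervalIntegral.integral_sub hu.1 hw.1, mul_sub, ← hu.2, ← hw.2]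
    linear_combination hdom hU s hs - hdom hW s hs
  · rw [hnl hU, hnl hW]
    ring

theorem IsDiagonalized.eqOn_of_isNonlocalSolution {v : HilbertBasis ℕ 𝕜 H}
    {lam : ℕ → ℝ} (h : IsDiagonalized A v lam) (hρ0 : 0 < ρ) (hρ1 : ρ < 1) (hγ : 0 < γ)
    (hT : 0 < T) {W : ℝ → H} (hU : IsNonlocalSolution A ρ γ T ψ U)
    (hW : IsNonlocalSolution A ρ γ T ψ W) : EqOn U W (Icc 0 T) := by
  intro t ht
  refine ext_inner_basis v fun k => sub_eq_zero.1 ?_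
  rw [← inner_sub_right]
  -- The maximum principle is real, so the coordinate is rotated: with this c, the real functional x
  -- ↦ Re(c̄ (v_k, x)) takes the value |c|² at U(t) - W(t).
  set c : 𝕜 := inner 𝕜 (v k) (U t - W t) with hc
  let φ : H →L[ℝ] ℝ := RCLike.reCLM.comp (innerReal 𝕜 (c • v k))
  have hφa : ∀ x, φ x = RCLike.re (starRingEnd 𝕜 c * inner 𝕜 (v k) x) := fun x => by
    rw [← inner_smul_left]
    rfl
  have hφ : ∀ x ∈ A.domain, φ (opVal A x) = lam k * φ x := fun x hx => by
    rw [hφa, hφa, h.inner_opVal hx, mul_left_comm, RCLike.re_ofReal_mul]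
  have heq : φ (U t - W t) = 0 := by
    rw [map_sub, sub_eq_zero]
    exact le_antisymm (hU.functional_le hW hρ0 hρ1 hγ hT φ (h.pos k) hφ ht)
      (hW.functional_le hU hρ0 hρ1 hγ hT φ (h.pos k) hφ ht)
  rw [hφa, ← hc, RCLike.conj_mul] at heq
  have h2 : ‖c‖ ^ 2 = 0 := by
    rw [← RCLike.ofReal_pow, RCLike.ofReal_re] at heq
    exact heq
  simpa using h2

end Uniqueness

end

end RayleighStokes

end

theorem theorem4p2 (ρ γ lam₁ T : ℝ) (hρ0 : 0 < ρ) (hρ1 : ρ < 1) (hγ : 0 < γ)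
    (hlam₁ : 0 < lam₁) (hT : 0 < T) :
    ∃ C : ℝ, 0 < C ∧
      ∀ (𝕜 : Type*) [RCLike 𝕜] (H : Type*) [NormedAddCommGroup H] [InnerProductSpace 𝕜 H]
        [NormedSpace ℝ H] [CompleteSpace H]
        (A : H →ₗ.[𝕜] H) (v : HilbertBasis ℕ 𝕜 H) (lam : ℕ → ℝ),
        RayleighStokes.IsDiagonalized A v lam → lam 0 = lam₁ →
        ∀ ψ ∈ A.domain, ∃ W : ℝ → H,
          RayleighStokes.IsNonlocalSolution A ρ γ T ψ W ∧
          (∀ U : ℝ → H, RayleighStokes.IsNonlocalSolution A ρ γ T ψ U →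
            Set.EqOn U W (Set.Icc 0 T)) ∧
          (∀ t ∈ Set.Icc 0 T,
            HasSum
              (fun k : ℕ =>
                (((RayleighStokes.relaxation ρ γ (lam k) t /
                    (RayleighStokes.relaxation ρ γ (lam k) T - 1) : ℝ) : 𝕜) *
                  inner 𝕜 (v k) ψ) • v k)
              (W t)) ∧
          ∀ t ∈ Set.Ioc 0 T,
            ‖derivWithin W (Set.Icc 0 T) t‖ ^ 2 + ‖RayleighStokes.opVal A (W t)‖ ^ 2 +
                ‖RayleighStokes.opVal A (RayleighStokes.caputo ρ W t)‖ ^ 2 ≤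
              C * ‖RayleighStokes.opVal A ψ‖ ^ 2 := by
  have hgap := RayleighStokes.relaxationGap_pos hρ1 hγ hlam₁ hT
  refine ⟨(RayleighStokes.relaxationGap ρ γ lam₁ T)⁻¹ ^ 2 * (2 + γ⁻¹ ^ 2), by positivity, ?_⟩
  intro 𝕜 _ H _ _ _ _ A v lam h h0 ψ hψ
  have hlam : ∀ k, lam₁ ≤ lam k := fun k => h0 ▸ h.mono (Nat.zero_le k)
  have hsol := h.isNonlocalSolution hρ0 hρ1 hγ hlam₁ hT hlam hψ
  refine ⟨_, hsol, fun U hU => h.eqOn_of_isNonlocalSolution hρ0 hρ1 hγ hT hU hsol,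
    fun t ht => ?_, fun t ht => h.solution_bound hρ0 hρ1 hγ hlam₁ hT hlam hψ ht⟩
  rw [RayleighStokes.solution_eq_diag v hρ0 hρ1 hγ hlam₁ hT hlam (h.inner_opVal hψ) ht.1]
  exact RayleighStokes.hasSum_diag v
    (fun k => RayleighStokes.abs_coeff_le hρ0 hρ1 hγ hlam₁ hT (hlam k) ht.1) ψ
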